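/- Theorem (convergence of PAPC). Let $X\subseteq\mathbb R^n$ be closed and convex, let $Z^i\subset\mathbb R^{d_i}$ ($i=1,\dots,m$) be nonempty, convex and compact, and consider $$\min\{c^\top x:\ x\in X,\ f_i(x)\le 0\ (i=1,\dots,m),\ Ax=b\},\qquad f_i(x)=\max_{z\in Z^i} g_i(x,z),$$ with biaffine $g_i(x,z)=x^\top Q_iz+d_i^\top x+q_i^\top z+\gamma_i$ and $A\in\mathbb R^{r\times n}$ of full row rank. Assume that $x^*$ is an optimal solution, and that $\hat x\in\operatorname{int}X$ and $\epsilon>0$ satisfy $A\hat x=b$ and, for all $\|y\|\le\epsilon$ and all $i$, $\hat x+y\in X$ and $f_i(\hat x+y)<0$. Let $\underline v<c^\top x^*$. Put $\tilde Q_i=[Q_i\ \ d_i]$, $\tilde q_i=(q_i,\gamma_i)$, $U^i=\{(\tilde z,\mu):\mu\ge 0,\ \tilde z\in\mu Z^i\}$, $\bar Q=[\tilde Q_1,\dots,\tilde Q_m,A^\top,I_n]$, and $\sigma_X(\pi)=\sup_{x\in X}\pi^\top x$. For step sizes $\tau,\theta_1,\dots,\theta_m,\theta_w,\theta_\pi>0$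 let $S=\operatorname{diag}(\theta_1^{-1}I_{d_1+1},\dots,\theta_m^{-1}I_{d_m+1},\theta_w^{-1}I_r,\theta_\pi^{-1}I_n)$ and assume $S-\tau\bar Q^\top\bar Q\succ 0$. From any $x^0\in\mathbb R^n$ and $y^0=(u^0,w^0,\pi^0)$ with $u^0_i=(\tilde z_i^0,\lambda_i^0)\in U^i$, $w^0\in\mathbb R^r$, $\pi^0\in\mathbb R^n$, the algorithm PAPC generates, for $k\ge 1$, $$p^k=x^{k-1}-\tau(c+\bar Qy^{k-1}),\quad u_i^k=P_{U^i}\big(u_i^{k-1}+\theta_i(\tilde Q_i^\top p^k+\tilde q_i)\big),\quad w^k=w^{k-1}+\theta_w(Ap^k-b),$$ $$\pi^k=\operatorname{prox}_{\theta_\pi\sigma_X}(\pi^{k-1}+\theta_\pi p^k),\quad y^k=(u^k,w^k,\pi^k),\quad x^k=x^{k-1}-\tau(c+\bar Qy^k).$$ Define $R_i=\max_{z\in Z^i}\|z\|$, $\Gamma=\max\{2,\max_i(1+4R_i^2)\}$ and $$\bar\lambda=\frac{c^\top\hat x-\underline v}{-\max_i f_i(\hat x)},\quad R_w=\frac1{\sigma_{\min}(A)}\Big(\frac{c^\top\hat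 x-\underline v}{\epsilon}+\|c\|\Big),\quad R_\pi=\|c\|+\|A\|R_w+\bar\lambda\sum_{i=1}^m\|\tilde Q_i\|(R_i+1),$$ with Euclidean norms of vectors, spectral norms of matrices, and $\sigma_{\min}(A)$ the smallest of the $r$ singular values of $A$ (if $r=0$, put $R_w=0$; if $m=0$, put $\bar\lambda=0$ and $\Gamma=2$). Then for every $N\ge 1$ the average $\bar x^N=\frac1N\sum_{k=1}^Nx^k$ satisfies, for every $\alpha>0$, $$\sum_{i=1}^m[f_i(\bar x^N)]_++\|A\bar x^N-b\|+\alpha\,\mathrm{dist}(\bar x^N,X)\le\frac{\Gamma}{2N}\Big(\frac{\|x^*-x^0\|^2}{\tau}+\sum_{i=1}^m\frac{\max\{\bar\lambda+1,\lambda_i^0\}^2}{\theta_i}+\frac{\|\pi^0\|^2+(R_\pi+\alpha)^2}{\theta_\pi}\Big)+\frac{(R_w+1+\|w^0\|)^2}{2N\theta_w},$$ and $$|c^\top(\bar x^N-x^*)|\le\frac{\Gamma}{2N}\Big(\frac{\|x^*-x^0\|^2}{\tau}+\sum_{i=1}^m\frac{\max\{2\bar\lambda,\lambda_i^0\}^2}{\theta_i}+\frac{\|\pi^0\|^2+4R_\pi^2}{\theta_\pi}\Big)+\frac{(2R_w+\|w^0\|)^2}{2N\theta_w}.$$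 -/

import Mathlib

open scoped Pointwise Matrix Matrix.Norms.L2Operator

noncomputable section

namespace RobustPAPC

/-- Euclidean space `ℝ^k`. -/
abbrev Vec (k : ℕ) : Type := EuclideanSpace ℝ (Fin k)

/-- The lifted space `ℝ^(k+1)` of pairs `(z̃, μ)`, with the Euclidean norm: `Sum.inl j` indexes the
coordinates of `z̃ ∈ ℝ^k` and `Sum.inr ()` indexes the scalar `μ`. -/
abbrev Lifted (k : ℕ) : Type := EuclideanSpace ℝ (Fin k ⊕ Unit)

/-- The part `z̃` of a lifted vector `(z̃, μ)`. -/
def Lifted.fst {k : ℕ} (u : Lifted k) : Vec k := WithLp.toLp 2 fun j => u (Sum.inl j)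

/-- The scalar part `μ` of a lifted vector `(z̃, μ)`. -/
def Lifted.snd {k : ℕ} (u : Lifted k) : ℝ := u (Sum.inr ())

/-- Application of a real matrix to a vector of a Euclidean space. -/
def act {ι κ : Type} [Fintype ι] [Fintype κ] [DecidableEq κ]
    (M : Matrix ι κ ℝ) (v : EuclideanSpace ℝ κ) : EuclideanSpace ℝ ι :=
  Matrix.toEuclideanLin M v

/-- `p` is a Euclidean (metric) projection of `v` onto the set `C`. -/
def IsProj {E : Type} [NormedAddCommGroup E] (C : Set E) (v p : E) : Prop :=
  p ∈ C ∧ ∀ q ∈ C, ‖v - p‖ ≤ ‖v - q‖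

/-- The support function `σ_C(π) = sup_{x ∈ C} πᵀx`, with values in the extended reals. -/
def supportFun {k : ℕ} (C : Set (Vec k)) (π : Vec k) : EReal :=
  ⨆ x ∈ C, ((inner ℝ π x : ℝ) : EReal)

/-- `p = prox_{tφ}(v)`: `p` minimizes `t φ(q) + ‖q - v‖² / 2` over all `q`. -/
def IsProx {k : ℕ} (t : ℝ) (φ : Vec k → EReal) (v p : Vec k) : Prop :=
  ∀ q : Vec k, (t : EReal) * φ p + ((‖p - v‖ ^ 2 / 2 : ℝ) : EReal) ≤
    (t : EReal) * φ q + ((‖q - v‖ ^ 2 / 2 : ℝ) : EReal)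

/-- The data of a robust problem with biaffine constraint functions:
minimize `cᵀx` over `x ∈ X` subject to `max_{z ∈ Z i} g i x z ≤ 0` for all `i`, and `A x = b`, where
`g i x z = xᵀ Q_i z + d_iᵀ x + q_iᵀ z + γ_i`. -/
structure Problem (n m r : ℕ) where
  /-- dimension of the `i`-th uncertain parameter -/
  dim : Fin m → ℕ
  X : Set (Vec n)
  Z : (i : Fin m) → Set (Vec (dim i))
  c : Vec n
  A : Matrix (Fin r) (Fin n) ℝ
  b : Vec r
  Q : (i : Fin m) → Matrix (Fin n) (Fin (dim i)) ℝ
  d : Fin m → Vec n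
  q : (i : Fin m) → Vec (dim i)
  γ : Fin m → ℝ
  isClosed_X : IsClosed X
  convex_X : Convex ℝ X
  isCompact_Z : ∀ i, IsCompact (Z i)
  convex_Z : ∀ i, Convex ℝ (Z i)
  nonempty_Z : ∀ i, (Z i).Nonempty

namespace Problem

variable {n m r : ℕ} (P : Problem n m r)

/-- The biaffine constraint function `g_i(x, z)`. -/
def g (i : Fin m) (x : Vec n) (z : Vec (P.dim i)) : ℝ :=
  inner ℝ x (act (P.Q i) z) + inner ℝ (P.d i) x + inner ℝ (P.q i) z + P.γ i

/-- The robust counterpart `f_i(x) = max_{z ∈ Z i} g_i(x, z)`; the supremum is attained because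
`Z i` is compact and nonempty. -/
def f (i : Fin m) (x : Vec n) : ℝ := ⨆ z : P.Z i, P.g i x z

/-- The feasible set of the robust problem. -/
def feasible : Set (Vec n) := {x | x ∈ P.X ∧ (∀ i, P.f i x ≤ 0) ∧ act P.A x = P.b}

/-- `x` is an optimal solution of the robust problem. -/
def IsOptimal (x : Vec n) : Prop :=
  x ∈ P.feasible ∧ ∀ x' ∈ P.feasible, inner ℝ P.c x ≤ inner ℝ P.c x'

/-- `xhat` is a Slater point with radius `ε`. -/
def IsSlater (xhat : Vec n) (ε : ℝ) : Prop :=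
  xhat ∈ interior P.X ∧ act P.A xhat = P.b ∧ 0 < ε ∧
    ∀ y : Vec n, ‖y‖ ≤ ε → xhat + y ∈ P.X ∧ ∀ i, P.f i (xhat + y) < 0

/-- `Q̃_i = [Q_i  d_i]`. -/
def Qt (i : Fin m) : Matrix (Fin n) (Fin (P.dim i) ⊕ Unit) ℝ :=
  Matrix.fromCols (P.Q i) (Matrix.replicateCol Unit (P.d i))

/-- `q̃_i = (q_i, γ_i)`. -/
def qt (i : Fin m) : Lifted (P.dim i) :=
  WithLp.toLp 2 (Sum.elim (fun j => P.q i j) (fun _ => P.γ i))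

/-- The lifted uncertainty set `U^i = {(z̃, μ) : μ ≥ 0, z̃ ∈ μ Z^i}`. -/
def U (i : Fin m) : Set (Lifted (P.dim i)) := {u | 0 ≤ u.snd ∧ u.fst ∈ u.snd • P.Z i}

/-- Coordinates of the dual variable `y = (u_1, …, u_m, w, π)`. -/
abbrev DualIdx : Type := (Σ i : Fin m, (Fin (P.dim i) ⊕ Unit)) ⊕ (Fin r ⊕ Fin n)

/-- `Q̄ = [Q̃_1, …, Q̃_m, Aᵀ, I]`. -/
def Qbar : Matrix (Fin n) P.DualIdx ℝ :=
  Matrix.fromCols (Matrix.of fun a s => P.Qt s.1 a s.2) (Matrix.fromCols P.Aᵀ 1)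

/-- The block-diagonal matrix `S = diag(θ_1⁻¹ I, …, θ_m⁻¹ I, θ_w⁻¹ I, θ_π⁻¹ I)`. -/
def S (θ : Fin m → ℝ) (θw θπ : ℝ) : Matrix P.DualIdx P.DualIdx ℝ :=
  Matrix.diagonal
    (Sum.elim (fun s => (θ s.1)⁻¹) (Sum.elim (fun _ => θw⁻¹) (fun _ => θπ⁻¹)))

/-- `H = S - τ Q̄ᵀ Q̄`. -/
def H (τ : ℝ) (θ : Fin m → ℝ) (θw θπ : ℝ) : Matrix P.DualIdx P.DualIdx ℝ :=
  P.S θ θw θπ - τ • (P.Qbarᵀ * P.Qbar)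

/-- The vector `Q̄ y = ∑ i, Q̃_i u_i + Aᵀ w + π` for `y = (u, w, π)`. -/
def Qy (u : (i : Fin m) → Lifted (P.dim i)) (w : Vec r) (π : Vec n) : Vec n :=
  (∑ i, act (P.Qt i) (u i)) + act P.Aᵀ w + π

/-- The predictor `x - τ (c + Q̄ y)`. -/
def predictor (τ : ℝ) (x : Vec n) (u : (i : Fin m) → Lifted (P.dim i)) (w : Vec r)
    (π : Vec n) : Vec n :=
  x - τ • (P.c + P.Qy u w π)

/-- The sequences `x k`, `u k`, `w k`, `π k` are generated by the proximal alternating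
predictor-corrector method with step sizes `τ`, `θ`, `θw`, `θπ`, started at an arbitrary point
with `u 0 i ∈ U^i`. -/
structure IsPAPC (τ : ℝ) (θ : Fin m → ℝ) (θw θπ : ℝ) (x : ℕ → Vec n)
    (u : ℕ → (i : Fin m) → Lifted (P.dim i)) (w : ℕ → Vec r) (π : ℕ → Vec n) : Prop where
  u_init : ∀ i, u 0 i ∈ P.U i
  u_step : ∀ k i, IsProj (P.U i)
    (u k i + θ i • (act (P.Qt i)ᵀ (P.predictor τ (x k) (u k) (w k) (π k)) + P.qt i))
    (u (k + 1) i)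
  w_step : ∀ k, w (k + 1) =
    w k + θw • (act P.A (P.predictor τ (x k) (u k) (w k) (π k)) - P.b)
  π_step : ∀ k, IsProx θπ (supportFun P.X)
    (π k + θπ • P.predictor τ (x k) (u k) (w k) (π k)) (π (k + 1))
  x_step : ∀ k, x (k + 1) = x k - τ • (P.c + P.Qy (u (k + 1)) (w (k + 1)) (π (k + 1)))

/-- `R_i = max_{z ∈ Z i} ‖z‖`. -/
def R (i : Fin m) : ℝ := ⨆ z : P.Z i, ‖(z : Vec (P.dim i))‖

/-- `λ̄ = (cᵀ xhat - v) / min_i (-f_i(xhat)) = (cᵀ xhat - v) / (-max_i f_i(xhat))`. -/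
def lamBar (xhat : Vec n) (v : ℝ) : ℝ := (inner ℝ P.c xhat - v) / (-(⨆ i, P.f i xhat))

/-- The smallest singular value of the full-row-rank `r × n` matrix `A`, that is, the last one of
the `r` singular values (numbered from `0` in decreasing order) of `Aᵀ : ℝ^r → ℝ^n`. -/
def sigmaMin : ℝ := (Matrix.toEuclideanLin P.Aᵀ).singularValues (r - 1)

/-- `R_w = ((cᵀ xhat - v) / ε + ‖c‖) / σ_min(A)`. -/
def Rw (xhat : Vec n) (ε v : ℝ) : ℝ :=
  1 / P.sigmaMin * ((inner ℝ P.c xhat - v) / ε + ‖P.c‖)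

/-- `R_π = ‖c‖ + ‖A‖ R_w + λ̄ ∑ i, ‖Q̃_i‖ (R_i + 1)`, with spectral norms of matrices. -/
def Rπ (xhat : Vec n) (ε v : ℝ) : ℝ :=
  ‖P.c‖ + ‖P.A‖ * P.Rw xhat ε v + P.lamBar xhat v * ∑ i, ‖P.Qt i‖ * (P.R i + 1)

/-- `Γ = max {2, max_i (1 + 4 R_i²)}`. -/
def Γ : ℝ := max 2 (⨆ i, (1 + 4 * P.R i ^ 2))

end Problem

/-- The ergodic average `(1/N) ∑_{k=1}^N x k`. -/
def ergodic {n : ℕ} (x : ℕ → Vec n) (N : ℕ) : Vec n :=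
  (1 / (N : ℝ)) • ∑ k ∈ Finset.Icc 1 N, x k

end RobustPAPC

end

/-! Let L(x; y), y = (u, w, π), be the Lagrangian `lag`, in which a number s bounding πᵀx on X
stands for σ_X(π). The lifting z̃ = λz makes λ g_i(x, z) linear in u_i, so L is affine in x and L −
cᵀx is linear in (y, s).

For every admissible y', the quantity ‖x* − x^k‖²/τ + ‖y' − y^k‖²_H with H = S − τQ̄ᵀQ̄ drops in
each step by at least 2(L(x^{k+1}; y') − cᵀx*) (`IsPAPC.two_mul_gap_le`). The three-point identity
turns each update into differences of squares, and the error of the predictor supplies the part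
−τ‖Q̄ ·‖² of the H-norm. Telescoping, together with affinity in x, bounds L(x̄; y') − cᵀx* by O(1/N)
(`IsPAPC.ergodic_gap_le`).

It remains to choose y'. The Slater point yields a bounded y* with L(·; y*) constantly equal to cᵀx*
(`exists_bounded_dual`): separation gives multipliers, Sion's theorem fixes worst-case parameters z,
and π* cancels the remaining slope in x. If d is a direction detecting violation
(`exists_violation_direction`), then y' = y* + d makes the gap equal to the total infeasibility,
while y' = 0 and y' = 2y* make it cᵀ(x̄ − x*) and its negative. -/

noncomputable section

namespace RobustPAPC

section Act

variable {ι κ : Type} [Fintype ι] [Fintype κ] [DecidableEq κ]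

lemma act_add (M : Matrix ι κ ℝ) (v w : EuclideanSpace ℝ κ) :
    act M (v + w) = act M v + act M w := map_add _ _ _

lemma act_sub (M : Matrix ι κ ℝ) (v w : EuclideanSpace ℝ κ) :
    act M (v - w) = act M v - act M w := map_sub _ _ _

lemma act_smul (M : Matrix ι κ ℝ) (a : ℝ) (v : EuclideanSpace ℝ κ) :
    act M (a • v) = a • act M v := map_smul _ _ _

lemma ofLp_act (M : Matrix ι κ ℝ) (v : EuclideanSpace ℝ κ) :
    WithLp.ofLp (act M v) = M *ᵥ WithLp.ofLp v := rfl

lemma norm_act_le (M : Matrix ι κ ℝ) (v : EuclideanSpace ℝ κ) : ‖act M v‖ ≤ ‖M‖ * ‖v‖ :=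
  Matrix.l2_opNorm_mulVec M v

lemma inner_act_transpose [DecidableEq ι] (M : Matrix ι κ ℝ) (v : EuclideanSpace ℝ ι) (w : EuclideanSpace ℝ κ) :
    inner ℝ (act Mᵀ v) w = inner ℝ v (act M w) := by
  rw [EuclideanSpace.inner_eq_star_dotProduct, EuclideanSpace.inner_eq_star_dotProduct, ofLp_act,
    ofLp_act]
  simp [Matrix.mulVec_transpose, Matrix.dotProduct_mulVec, dotProduct_comm]

lemma norm_transpose [DecidableEq ι] (M : Matrix ι κ ℝ) : ‖Mᵀ‖ = ‖M‖ := by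
  rw [← Matrix.l2_opNorm_conjTranspose M, Matrix.conjTranspose_eq_transpose_of_trivial]

end Act

/-! ### Variational inequalities for projections and proximal points. -/

lemma IsProj.inner_sub_sub_nonpos {E : Type} [NormedAddCommGroup E] [InnerProductSpace ℝ E]
    {C : Set E} (hC : Convex ℝ C) {v p : E} (h : IsProj C v p) {q : E} (hq : q ∈ C) :
    inner ℝ (v - p) (q - p) ≤ 0 := by
  refine (norm_eq_iInf_iff_real_inner_le_zero hC h.1).1 ?_ q hq
  have : Nonempty C := ⟨⟨p, h.1⟩⟩
  refine le_antisymm (le_ciInf fun q => h.2 q q.2) ?_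
  exact ciInf_le (f := fun w : C => ‖v - w‖) ⟨0, by rintro _ ⟨y, rfl⟩; positivity⟩ ⟨p, h.1⟩

lemma supportFun_le {k : ℕ} {C : Set (Vec k)} {π : Vec k} {s : ℝ}
    (h : ∀ x ∈ C, inner ℝ π x ≤ s) : supportFun C π ≤ (s : EReal) :=
  iSup₂_le fun x hx => EReal.coe_le_coe_iff.2 (h x hx)

lemma nonneg_of_forall_add_mul_nonneg {a b : ℝ} (h : ∀ η : ℝ, 0 < η → η ≤ 1 → 0 ≤ a + η * b) :
    0 ≤ a := by
  by_contra! ha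
  have hb : 0 < b := by have := h 1 one_pos le_rfl; linarith
  have h1 := h (min 1 (-a / (2 * b))) (lt_min one_pos (div_pos (by linarith) (by linarith)))
    (min_le_left _ _)
  have h2 : min 1 (-a / (2 * b)) * b ≤ -a / (2 * b) * b := by gcongr; exact min_le_right _ _
  have h3 : -a / (2 * b) * b = -a / 2 := by field_simp
  linarith

/-- The proximal point of a support function is a point where it is finite, and satisfies the
variational inequality. -/
lemma IsProx.exists_inner_le {k : ℕ} {C : Set (Vec k)} (hC : C.Nonempty) {t : ℝ} (ht : 0 < t)
    {v p : Vec k} (h : IsProx t (supportFun C) v p) :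
    ∃ s' : ℝ, (∀ x ∈ C, inner ℝ p x ≤ s') ∧
      ∀ (π : Vec k) (s : ℝ), (∀ x ∈ C, inner ℝ π x ≤ s) →
        inner ℝ (v - p) (π - p) ≤ t * (s - s') := by
  have key : ∀ (π : Vec k) (s : ℝ), (∀ x ∈ C, inner ℝ π x ≤ s) →
      (t : EReal) * supportFun C p + ((‖p - v‖ ^ 2 / 2 : ℝ) : EReal) ≤
        ((t * s + ‖π - v‖ ^ 2 / 2 : ℝ) : EReal) := by
    intro π s hs
    refine (h π).trans ?_
    rw [EReal.coe_add, EReal.coe_mul]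
    gcongr
    exact supportFun_le hs
  obtain ⟨x₀, hx₀⟩ := hC
  -- Finiteness at p: a point of C excludes ⊥, and comparison with the competitor 0, where the
  -- support function is at most 0, excludes ⊤.
  have hbot : supportFun C p ≠ ⊥ := fun hb => by
    have : ((inner ℝ p x₀ : ℝ) : EReal) ≤ supportFun C p :=
      le_iSup₂ (f := fun x (_ : x ∈ C) => ((inner ℝ p x : ℝ) : EReal)) x₀ hx₀
    rw [hb] at this
    exact EReal.coe_ne_bot _ (le_bot_iff.1 this)
  have htop : supportFun C p ≠ ⊤ := fun hb => by
    have := key 0 0 (by simp)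
    rw [hb, EReal.coe_mul_top_of_pos ht, EReal.top_add_coe] at this
    exact EReal.coe_ne_top _ (top_le_iff.1 this)
  obtain ⟨s', hs'⟩ : ∃ s' : ℝ, (s' : EReal) = supportFun C p :=
    ⟨_, EReal.coe_toReal htop hbot⟩
  have hp : ∀ x ∈ C, inner ℝ p x ≤ s' := fun x hx => by
    rw [← EReal.coe_le_coe_iff, hs']
    exact le_iSup₂ (f := fun x (_ : x ∈ C) => ((inner ℝ p x : ℝ) : EReal)) x hx
  refine ⟨s', hp, fun π s hs => ?_⟩
  suffices 0 ≤ t * (s - s') - inner ℝ (v - p) (π - p) by linarith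
  -- First-order optimality: move from p towards π by η, where convexity bounds the support function
  -- by s' + η(s − s'), divide by η and let η tend to 0.
  refine nonneg_of_forall_add_mul_nonneg (b := ‖π - p‖ ^ 2 / 2) fun η h0 h1 => ?_
  have := key (p + η • (π - p)) (s' + η * (s - s')) fun x hx => by
    have e : inner ℝ (p + η • (π - p)) x = (1 - η) * inner ℝ p x + η * inner ℝ π x := by
      simp only [inner_add_left, real_inner_smul_left, inner_sub_left]; ring
    rw [e]
    nlinarith [hs x hx, hp x hx]
  rw [← hs', ← EReal.coe_mul, ← EReal.coe_add, EReal.coe_le_coe_iff] at this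
  have e : ‖p + η • (π - p) - v‖ ^ 2
      = ‖p - v‖ ^ 2 - 2 * η * inner ℝ (v - p) (π - p) + η ^ 2 * ‖π - p‖ ^ 2 := by
    rw [show p + η • (π - p) - v = (p - v) + η • (π - p) by abel, norm_add_sq_real,
      real_inner_smul_right, norm_smul, mul_pow, Real.norm_eq_abs, sq_abs,
      show p - v = -(v - p) by abel, inner_neg_left]
    ring
  rw [e] at this
  have h2 : 0 ≤ η * (t * (s - s') - inner ℝ (v - p) (π - p) + η * (‖π - p‖ ^ 2 / 2)) := by
    nlinarith
  exact nonneg_of_mul_nonneg_right h2 h0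

/-- The unit vector from the projection towards y is an outward normal; if y lies in C, the zero
vector serves. -/
lemma exists_normal_infDist {k : ℕ} {C : Set (Vec k)} (hne : C.Nonempty) (hcl : IsClosed C)
    (hC : Convex ℝ C) (y : Vec k) :
    ∃ e : Vec k, ‖e‖ ≤ 1 ∧ ∀ x ∈ C, inner ℝ e x ≤ inner ℝ e y - Metric.infDist y C := by
  obtain ⟨p, hp, hyp⟩ := exists_norm_eq_iInf_of_complete_convex hne hcl.isComplete hC y
  have hd : Metric.infDist y C = ‖y - p‖ := by
    rw [Metric.infDist_eq_iInf, hyp]; simp [dist_eq_norm]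
  have hv := (norm_eq_iInf_iff_real_inner_le_zero hC hp).1 hyp
  rcases eq_or_ne (y - p) 0 with h0 | h0
  · exact ⟨0, by simp, by simp [hd, h0]⟩
  · have hn : 0 < ‖y - p‖ := norm_pos_iff.2 h0
    refine ⟨‖y - p‖⁻¹ • (y - p), by simp [norm_smul, hn.ne'], fun x hx => ?_⟩
    have := hv x hx
    rw [hd, real_inner_smul_left, real_inner_smul_left]
    have e : inner ℝ (y - p) y - inner ℝ (y - p) p = ‖y - p‖ ^ 2 := by
      rw [← inner_sub_right, real_inner_self_eq_norm_sq]
    rw [inner_sub_right] at this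
    have : ‖y - p‖⁻¹ * inner ℝ (y - p) x ≤ ‖y - p‖⁻¹ * (inner ℝ (y - p) y - ‖y - p‖ ^ 2) := by
      gcongr; linarith
    refine this.trans_eq ?_
    field_simp

/-- Expand ‖T v‖² in an eigenbasis of T*T: every eigenvalue is at least the square of the last
singular value. -/
lemma singularValues_pred_finrank_mul_norm_le {E F : Type*} [NormedAddCommGroup E]
    [InnerProductSpace ℝ E] [FiniteDimensional ℝ E] [NormedAddCommGroup F] [InnerProductSpace ℝ F]
    [FiniteDimensional ℝ F] (T : E →ₗ[ℝ] F) {d : ℕ} (hd : Module.finrank ℝ E = d) (v : E) :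
    T.singularValues (d - 1) * ‖v‖ ≤ ‖T v‖ := by
  have hs := T.isSymmetric_adjoint_comp_self
  let B := hs.eigenvectorBasis hd
  have h1 : ‖T v‖ ^ 2 = ∑ i, hs.eigenvalues hd i * inner ℝ (B i) v ^ 2 := by
    rw [← real_inner_self_eq_norm_sq, ← LinearMap.adjoint_inner_left, ← LinearMap.comp_apply,
      ← B.sum_inner_mul_inner]
    refine Finset.sum_congr rfl fun i _ => ?_
    rw [hs, hs.apply_eigenvectorBasis, real_inner_smul_right, real_inner_comm v (B i)]
    simp only [RCLike.ofReal_real_eq_id, id_eq, B]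
    ring
  have h2 : ‖v‖ ^ 2 = ∑ i, inner ℝ (B i) v ^ 2 := by
    rw [← real_inner_self_eq_norm_sq, ← B.sum_inner_mul_inner]
    refine Finset.sum_congr rfl fun i _ => ?_
    rw [real_inner_comm v (B i)]
    ring
  refine le_of_sq_le_sq ?_ (norm_nonneg _)
  rw [mul_pow, h1, h2, Finset.mul_sum]
  refine Finset.sum_le_sum fun i _ => ?_
  gcongr
  rw [← T.sq_singularValues_fin hd i]
  have := T.singularValues_nonneg (d - 1)
  gcongr
  exact T.singularValues_antitone (by omega)

/-! ### The smallest singular value of A and the quadratic form of H. -/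

namespace Problem

variable {n m r : ℕ} (P : Problem n m r)

lemma sigmaMin_nonneg : 0 ≤ P.sigmaMin := LinearMap.singularValues_nonneg _ _

lemma sigmaMin_mul_norm_le (w : Vec r) : P.sigmaMin * ‖w‖ ≤ ‖act P.Aᵀ w‖ :=
  singularValues_pred_finrank_mul_norm_le (Matrix.toEuclideanLin P.Aᵀ) (by simp) w

lemma sigmaMin_pos (hA : LinearIndependent ℝ P.A.row) (hr : 0 < r) : 0 < P.sigmaMin := by
  have hinj : Function.Injective (Matrix.toEuclideanLin P.Aᵀ) := by
    intro v w h
    have h' : P.Aᵀ *ᵥ WithLp.ofLp v = P.Aᵀ *ᵥ WithLp.ofLp w := congrArg WithLp.ofLp h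
    exact WithLp.ofLp_injective 2 (Matrix.mulVec_injective_iff.2 (by simpa using hA) h')
  refine (LinearMap.injective_iff_forall_lt_finrank_singularValues_pos _).1 hinj _ ?_
  simp only [finrank_euclideanSpace, Fintype.card_fin]
  omega

/-- The quadratic form `‖y‖²_H` of the dual variable `y = (u, w, π)`. -/
def quad (τ : ℝ) (θ : Fin m → ℝ) (θw θπ : ℝ) (u : (i : Fin m) → Lifted (P.dim i)) (w : Vec r)
    (π : Vec n) : ℝ :=
  ∑ i, ‖u i‖ ^ 2 / θ i + ‖w‖ ^ 2 / θw + ‖π‖ ^ 2 / θπ - τ * ‖P.Qy u w π‖ ^ 2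

lemma quad_nonneg {τ : ℝ} {θ : Fin m → ℝ} {θw θπ : ℝ} (hH : (P.H τ θ θw θπ).PosDef)
    (u : (i : Fin m) → Lifted (P.dim i)) (w : Vec r) (π : Vec n) :
    0 ≤ P.quad τ θ θw θπ u w π := by
  let y : P.DualIdx → ℝ := Sum.elim (fun s => u s.1 s.2) (Sum.elim (fun j => w j) (fun a => π a))
  have h := hH.posSemidef.dotProduct_mulVec_nonneg y
  have hQ : P.Qbar *ᵥ y = WithLp.ofLp (P.Qy u w π) := by
    ext a
    simp only [Qbar, Qy, y, PiLp.add_apply, WithLp.ofLp_sum, Finset.sum_apply, ofLp_act,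
      Matrix.mulVec, dotProduct, Fintype.sum_sum_type, Matrix.fromCols_apply_inl,
      Matrix.fromCols_apply_inr, Sum.elim_inl, Sum.elim_inr, Matrix.of_apply, Fintype.sum_sigma,
      Matrix.one_apply, ite_mul, one_mul, zero_mul, Finset.sum_ite_eq, Finset.mem_univ, if_true,
      add_assoc]
  have e : star y ⬝ᵥ (P.H τ θ θw θπ *ᵥ y) = P.quad τ θ θw θπ u w π := by
    rw [star_trivial, H, Matrix.sub_mulVec, dotProduct_sub, Matrix.smul_mulVec, ← Matrix.mulVec_mulVec, hQ,
      dotProduct_smul, Matrix.dotProduct_mulVec y P.Qbarᵀ, Matrix.vecMul_transpose, hQ, quad]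
    congr 1
    · simp only [S, dotProduct, Matrix.mulVec_diagonal, y, Fintype.sum_sum_type, Sum.elim_inl,
        Sum.elim_inr, Fintype.sum_sigma, EuclideanSpace.real_norm_sq_eq, Finset.sum_div]
      rw [add_assoc]
      congr 1
      · refine Finset.sum_congr rfl fun i _ => ?_
        rw [add_div, Finset.sum_div, Finset.sum_div]
        congr 1 <;> refine Finset.sum_congr rfl fun j _ => ?_ <;> ring
      · congr 1 <;> refine Finset.sum_congr rfl fun j _ => ?_ <;> ring
    · rw [EuclideanSpace.real_norm_sq_eq, smul_eq_mul]
      congr 1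
      refine Finset.sum_congr rfl fun j _ => ?_
      ring
  rwa [e] at h

end Problem

/-! ### Minimax and Lagrange multipliers. -/

/-- Sion's theorem with attainment on the compact side only. -/
lemma exists_forall_le_of_forall_exists_le {E F : Type*} [TopologicalSpace E] [AddCommGroup E]
    [Module ℝ E] [IsTopologicalAddGroup E] [ContinuousSMul ℝ E] [TopologicalSpace F]
    [AddCommGroup F] [Module ℝ F] [IsTopologicalAddGroup F] [ContinuousSMul ℝ F]
    {Z : Set E} {Y : Set F} (hZne : Z.Nonempty) (hZ : Convex ℝ Z) (hZc : IsCompact Z)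
    (hY : Convex ℝ Y) {h : E → F → ℝ}
    (hz : ∀ y ∈ Y, ContinuousOn (fun z => h z y) Z) (hz' : ∀ y ∈ Y, ConcaveOn ℝ Z fun z => h z y)
    (hy : ∀ z ∈ Z, ContinuousOn (h z) Y) (hy' : ∀ z ∈ Z, ConvexOn ℝ Y (h z))
    {c : ℝ} (hc : ∀ y ∈ Y, ∃ z ∈ Z, c ≤ h z y) : ∃ z ∈ Z, ∀ y ∈ Y, c ≤ h z y := by
  -- The sign is flipped because the compact side is the minimizing one in `Sion.minimax'`; extended
  -- reals allow an infinite supremum over Y.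
  let f : E → F → EReal := fun z y => ((-h z y : ℝ) : EReal)
  have mono : Monotone Real.toEReal := fun _ _ => EReal.coe_le_coe
  have h1 : ∀ y ∈ Y, LowerSemicontinuousOn (fun z => f z y) Z := fun y hyY =>
    (continuous_coe_real_ereal.comp_continuousOn (hz y hyY).neg).lowerSemicontinuousOn
  have h2 : ∀ y ∈ Y, QuasiconvexOn ℝ Z fun z => f z y := fun y hyY =>
    QuasiconvexOn.monotone_comp (g := Real.toEReal) mono (hz' y hyY).neg.quasiconvexOn
  have h3 : ∀ z ∈ Z, UpperSemicontinuousOn (fun y => f z y) Y := fun z hzZ =>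
    (continuous_coe_real_ereal.comp_continuousOn (hy z hzZ).neg).upperSemicontinuousOn
  have h4 : ∀ z ∈ Z, QuasiconcaveOn ℝ Y fun y => f z y := fun z hzZ =>
    QuasiconcaveOn.monotone_comp (g := Real.toEReal) mono (hy' z hzZ).neg.quasiconcaveOn
  have key := Sion.minimax' hZne hZ hZc h1 h2 hY h3 h4
  have hle : (⨆ y ∈ Y, ⨅ z ∈ Z, f z y) ≤ ((-c : ℝ) : EReal) := iSup₂_le fun y hyY => by
    obtain ⟨z, hzZ, hzc⟩ := hc y hyY
    exact (iInf₂_le z hzZ).trans (EReal.coe_le_coe (neg_le_neg hzc))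
  have hlsc : LowerSemicontinuousOn (fun z => ⨆ y ∈ Y, f z y) Z := fun z hzZ =>
    lowerSemicontinuousWithinAt_iSup fun y => lowerSemicontinuousWithinAt_iSup fun hyY =>
      h1 y hyY z hzZ
  obtain ⟨a, ha, ha'⟩ := hlsc.exists_isMinOn hZne hZc
  refine ⟨a, ha, fun y hyY => ?_⟩
  have hfa : f a y ≤ ((-c : ℝ) : EReal) :=
    (le_iSup₂ (f := fun y (_ : y ∈ Y) => f a y) y hyY).trans
      ((le_iInf₂ fun z hzZ => ha' hzZ).trans (key.trans_le hle))
  have := EReal.coe_le_coe_iff.1 hfa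
  linarith

/-- Lagrange multipliers for a convex program with a Slater point and surjective linear
equality constraints. -/
lemma exists_lagrange_multipliers {E F : Type*} [NormedAddCommGroup E] [NormedSpace ℝ E]
    [FiniteDimensional ℝ E] [NormedAddCommGroup F] [InnerProductSpace ℝ F] [FiniteDimensional ℝ F]
    {m : ℕ} {X : Set E} (hX : Convex ℝ X) {f₀ : E → ℝ} (hf₀ : ConvexOn ℝ Set.univ f₀)
    {f : Fin m → E → ℝ} (hf : ∀ i, ConvexOn ℝ Set.univ (f i)) (A : E →ₗ[ℝ] F)
    (hA : Function.Surjective A) {b : F} {x₀ : E} (hx₀ : x₀ ∈ interior X) (hx₀b : A x₀ = b)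
    (hx₀f : ∀ i, f i x₀ < 0) {c : ℝ}
    (hc : ∀ x ∈ X, (∀ i, f i x ≤ 0) → A x = b → c ≤ f₀ x) :
    ∃ (lam : Fin m → ℝ) (w : F), (∀ i, 0 ≤ lam i) ∧
      ∀ x ∈ interior X, c ≤ f₀ x + ∑ i, lam i * f i x + inner ℝ w (A x - b) := by
  have hcont₀ : Continuous f₀ := hf₀.locallyLipschitz.continuous
  have hcont : ∀ i, Continuous (f i) := fun i => (hf i).locallyLipschitz.continuous
  -- A strict epigraph of the perturbed problem. Its image under T is open and convex, and misses 0
  -- because 0 would come from a feasible point with value below c.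
  let O : Set (E × ℝ × (Fin m → ℝ)) :=
    {p | x₀ + p.1 ∈ interior X ∧ f₀ (x₀ + p.1) - c < p.2.1 ∧ ∀ i, f i (x₀ + p.1) < p.2.2 i}
  let T : (E × ℝ × (Fin m → ℝ)) →ₗ[ℝ] (ℝ × (Fin m → ℝ) × F) :=
    { toFun := fun p => (p.2.1, p.2.2, A p.1)
      map_add' := fun p q => by simp
      map_smul' := fun a p => by simp }
  have hT : Function.Surjective T := fun ⟨s, t, y⟩ => by
    obtain ⟨x, rfl⟩ := hA y
    exact ⟨(x, s, t), rfl⟩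
  have hOopen : IsOpen O := by
    have hO : O = {p | x₀ + p.1 ∈ interior X} ∩ ({p | f₀ (x₀ + p.1) - c < p.2.1} ∩
        ⋂ i, {p | f i (x₀ + p.1) < p.2.2 i}) := by
      ext p; simp [O]
    rw [hO]
    refine (isOpen_interior.preimage (continuous_const.add continuous_fst)).inter
      ((isOpen_lt (by fun_prop) (by fun_prop)).inter (isOpen_iInter_of_finite fun i => ?_))
    exact isOpen_lt ((hcont i).comp (by fun_prop)) (by fun_prop)
  have hOconv : Convex ℝ O := by
    rintro ⟨x, s, t⟩ ⟨hx1, hx2, hx3⟩ ⟨y, s', t'⟩ ⟨hy1, hy2, hy3⟩ a a' ha ha' haa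
    have e : x₀ + (a • x + a' • y) = a • (x₀ + x) + a' • (x₀ + y) := by
      rw [smul_add, smul_add, add_add_add_comm, ← add_smul, haa, one_smul]
    have comb : ∀ p q p' q' : ℝ, p < q → p' < q' → a * p + a' * p' < a * q + a' * q' := by
      intro p q p' q' h h'
      rcases ha.eq_or_lt with rfl | ha0
      · have : a' = 1 := by linarith
        subst this; linarith
      · nlinarith
    refine ⟨?_, ?_, fun i => ?_⟩
    · change x₀ + (a • x + a' • y) ∈ _
      rw [e]
      exact hX.interior hx1 hy1 ha ha' haa
    · change f₀ (x₀ + (a • x + a' • y)) - c < a * s + a' * s'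
      rw [e]
      have h1 := hf₀.2 (Set.mem_univ (x₀ + x)) (Set.mem_univ (x₀ + y)) ha ha' haa
      have h2 := comb _ _ _ _ hx2 hy2
      simp only [smul_eq_mul] at h1 h2
      have h3 : a * c + a' * c = c := by rw [← add_mul, haa, one_mul]
      linarith
    · change f i (x₀ + (a • x + a' • y)) < a * t i + a' * t' i
      rw [e]
      have h1 := (hf i).2 (Set.mem_univ (x₀ + x)) (Set.mem_univ (x₀ + y)) ha ha' haa
      have h2 := comb _ _ _ _ (hx3 i) (hy3 i)
      simp only [smul_eq_mul] at h1 h2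
      linarith
  have h0 : (0 : ℝ × (Fin m → ℝ) × F) ∉ T '' O := by
    rintro ⟨⟨x, s, t⟩, ⟨h1, h2, h3⟩, h4⟩
    obtain ⟨rfl, rfl, h5⟩ : s = 0 ∧ t = 0 ∧ A x = 0 := by simpa [T] using h4
    have := hc _ (interior_subset h1) (fun i => (h3 i).le) (by rw [map_add, h5, hx₀b, add_zero])
    simp only at h2
    linarith
  obtain ⟨φ, hφ⟩ := geometric_hahn_banach_point_open (hOconv.linear_image T)
    (T.isOpenMap_of_finiteDimensional hT O hOopen) h0
  let μ : ℝ := φ (1, 0, 0)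
  let l : Fin m → ℝ := fun i => φ (0, Pi.single i 1, 0)
  let w : F := (InnerProductSpace.toDual ℝ F).symm
    (φ.comp ((ContinuousLinearMap.inr ℝ ℝ ((Fin m → ℝ) × F)).comp
      (ContinuousLinearMap.inr ℝ (Fin m → ℝ) F)))
  have hdec : ∀ s t y, φ (s, t, y) = μ * s + ∑ i, l i * t i + inner ℝ w y := by
    intro s t y
    have hw : inner ℝ w y = φ (0, 0, y) := by
      simp [w, InnerProductSpace.toDual_symm_apply]
    have ht : t = ∑ i, t i • (Pi.single i 1 : Fin m → ℝ) := by
      ext j; simp [Finset.sum_apply, Pi.single_apply]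
    have hl : φ (0, t, 0) = ∑ i, l i * t i := by
      have e : ((0 : ℝ), t, (0 : F)) = ∑ i, t i • ((0 : ℝ), (Pi.single i 1 : Fin m → ℝ), (0 : F)) := by
        refine Prod.ext (by simp [Prod.fst_sum]) (Prod.ext ?_ (by simp [Prod.snd_sum]))
        simpa [Prod.snd_sum, Prod.fst_sum] using ht
      rw [e, map_sum]
      refine Finset.sum_congr rfl fun i _ => ?_
      rw [map_smul, smul_eq_mul, mul_comm]
    have hs : φ (s, 0, 0) = μ * s := by
      have e : (s, (0 : Fin m → ℝ), (0 : F)) = s • ((1 : ℝ), (0 : Fin m → ℝ), (0 : F)) := by simp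
      rw [e, map_smul, smul_eq_mul, mul_comm]
    rw [hw, ← hl, ← hs, ← map_add, ← map_add]
    simp
  have hpos : ∀ x ∈ interior X, ∀ (s : ℝ) (t : Fin m → ℝ), f₀ x - c < s → (∀ i, f i x < t i) →
      0 < μ * s + ∑ i, l i * t i + inner ℝ w (A x - b) := by
    intro x hx s t hs ht
    have := hφ (T (x - x₀, s, t)) ⟨_, ⟨by simpa using hx, by simpa using hs, by simpa using ht⟩, rfl⟩
    rw [map_zero] at this
    rw [← hdec]
    simpa [T, hx₀b] using this
  -- Raising s or a single t_i stays inside the epigraph, so the corresponding coefficients of φ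
  -- cannot be negative.
  have hunb : ∀ p q : ℝ, (∀ η : ℝ, 0 ≤ η → 0 < p + η * q) → 0 ≤ q := by
    intro p q h
    by_contra! hq
    have := h (|p| / -q) (div_nonneg (abs_nonneg _) (by linarith))
    rw [div_mul_eq_mul_div, div_neg, mul_div_assoc, div_self hq.ne] at this
    have := le_abs_self p
    linarith
  have hpos₀ : ∀ (s : ℝ) (t : Fin m → ℝ), f₀ x₀ - c < s → (∀ i, f i x₀ < t i) → 0 < μ * s + ∑ i, l i * t i := by
    intro s t hs ht
    simpa [hx₀b] using hpos x₀ hx₀ s t hs ht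
  have hμ : 0 ≤ μ := by
    refine hunb (μ * (f₀ x₀ - c + 1) + ∑ i, l i * (f i x₀ + 1)) μ fun η hη => ?_
    have := hpos₀ (f₀ x₀ - c + 1 + η) (fun i => f i x₀ + 1) (by linarith) fun i => by linarith
    linarith
  have hl : ∀ i, 0 ≤ l i := by
    intro i
    refine hunb (μ * (f₀ x₀ - c + 1) + ∑ i, l i * (f i x₀ + 1)) (l i) fun η hη => ?_
    have := hpos₀ (f₀ x₀ - c + 1) (fun j => f j x₀ + 1 + if j = i then η else 0) (by linarith)
      fun j => by split_ifs <;> linarith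
    simp only [mul_add (l _) (_ + 1), Finset.sum_add_distrib, mul_ite, mul_zero,
      Finset.sum_ite_eq', Finset.mem_univ, if_true] at this
    linarith
  -- If μ were 0, the levels t_i = f_i(x₀)/2 at the Slater point would make the strictly positive
  -- form nonpositive.
  have hμ0 : 0 < μ := by
    refine hμ.lt_of_ne fun h => ?_
    have := hpos₀ (f₀ x₀ - c + 1) (fun i => f i x₀ / 2) (by linarith)
      fun i => by linarith [hx₀f i]
    rw [← h, zero_mul, zero_add] at this
    refine this.not_ge (Finset.sum_nonpos fun i _ => ?_)
    exact mul_nonpos_of_nonneg_of_nonpos (hl i) (by linarith [hx₀f i])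
  refine ⟨fun i => l i / μ, μ⁻¹ • w, fun i => div_nonneg (hl i) hμ, fun x hx => ?_⟩
  have hnn : 0 ≤ μ * (f₀ x - c) + ∑ i, l i * f i x + inner ℝ w (A x - b) := by
    refine nonneg_of_forall_add_mul_nonneg (b := μ + ∑ i, l i) fun η h0 _ => ?_
    have := hpos x hx (f₀ x - c + η) (fun i => f i x + η) (by linarith) fun i => by linarith
    simp only [mul_add, Finset.sum_add_distrib, ← Finset.sum_mul] at this
    linarith
  have e : f₀ x + ∑ i, l i / μ * f i x + inner ℝ (μ⁻¹ • w) (A x - b) - c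
      = μ⁻¹ * (μ * (f₀ x - c) + ∑ i, l i * f i x + inner ℝ w (A x - b)) := by
    rw [real_inner_smul_left, mul_add, mul_add, inv_mul_cancel_left₀ hμ0.ne', Finset.mul_sum]
    have : ∀ i, l i / μ * f i x = μ⁻¹ * (l i * f i x) := fun i => by ring
    simp only [this]
    ring
  have := mul_nonneg (inv_nonneg.2 hμ) hnn
  rw [← e] at this
  linarith

/-! ### Lifted vectors, the constraint functions and the cones U^i. -/

namespace Lifted

variable {k : ℕ}

lemma fst_add (u v : Lifted k) : (u + v).fst = u.fst + v.fst := rfl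
lemma snd_add (u v : Lifted k) : (u + v).snd = u.snd + v.snd := rfl
lemma fst_sub (u v : Lifted k) : (u - v).fst = u.fst - v.fst := rfl
lemma snd_sub (u v : Lifted k) : (u - v).snd = u.snd - v.snd := rfl
lemma fst_smul (a : ℝ) (u : Lifted k) : (a • u).fst = a • u.fst := rfl
lemma snd_smul (a : ℝ) (u : Lifted k) : (a • u).snd = a * u.snd := rfl
lemma snd_zero : (0 : Lifted k).snd = 0 := rfl

lemma inner_eq (u v : Lifted k) : inner ℝ u v = inner ℝ u.fst v.fst + u.snd * v.snd := by
  simp [PiLp.inner_apply, fst, snd, Fintype.sum_sum_type, mul_comm]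

lemma norm_sq_eq (u : Lifted k) : ‖u‖ ^ 2 = ‖u.fst‖ ^ 2 + u.snd ^ 2 := by
  rw [← real_inner_self_eq_norm_sq, inner_eq, real_inner_self_eq_norm_sq, sq u.snd]

/-- The lifted vector `(a z, a)`. -/
def ray (a : ℝ) (z : Vec k) : Lifted k :=
  WithLp.toLp 2 (Sum.elim (fun j => (a • z) j) (fun _ => a))

lemma snd_ray (a : ℝ) (z : Vec k) : (ray a z).snd = a := rfl

end Lifted

lemma act_surjective {n r : ℕ} {A : Matrix (Fin r) (Fin n) ℝ} (hA : LinearIndependent ℝ A.row) :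
    Function.Surjective (Matrix.toEuclideanLin A) := by
  have h1 : A.rank = r := by simpa using hA.rank_matrix
  have h2 : Function.Surjective A.mulVecLin := by
    rw [← LinearMap.range_eq_top]
    apply Submodule.eq_top_of_finrank_eq
    simpa [Matrix.rank] using h1
  intro y
  obtain ⟨x, hx⟩ := h2 (WithLp.ofLp y)
  exact ⟨WithLp.toLp 2 x, WithLp.ofLp_injective 2 hx⟩

namespace Problem

variable {n m r : ℕ} (P : Problem n m r)

lemma act_Qt (i : Fin m) (u : Lifted (P.dim i)) :
    act (P.Qt i) u = act (P.Q i) u.fst + u.snd • P.d i := by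
  ext a
  simp [ofLp_act, Qt, Matrix.mulVec, dotProduct, Fintype.sum_sum_type, Lifted.fst, Lifted.snd,
    mul_comm]

/-- This is what the lifting achieves: a multiplier times a constraint value becomes linear in u. -/
lemma inner_dual_slope (i : Fin m) (x : Vec n) {u : Lifted (P.dim i)} {z : Vec (P.dim i)}
    (h : u.fst = u.snd • z) : inner ℝ (act (P.Qt i)ᵀ x + P.qt i) u = u.snd * P.g i x z := by
  have e1 : (P.qt i).fst = P.q i := rfl
  have e2 : (P.qt i).snd = P.γ i := rfl
  rw [inner_add_left, inner_act_transpose, act_Qt, Lifted.inner_eq, h, act_smul, e1, e2, g]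
  simp only [inner_add_right, real_inner_smul_right, real_inner_comm x (P.d i)]
  ring

lemma continuous_g (i : Fin m) (x : Vec n) : Continuous (P.g i x) := by
  have : Continuous fun z => act (P.Q i) z :=
    (Matrix.toEuclideanLin (P.Q i)).continuous_of_finiteDimensional
  unfold g
  fun_prop

lemma g_combo_left (i : Fin m) (z : Vec (P.dim i)) {a b : ℝ} (hab : a + b = 1) (x y : Vec n) :
    P.g i (a • x + b • y) z = a * P.g i x z + b * P.g i y z := by
  simp only [g, inner_add_left, inner_add_right, real_inner_smul_left, real_inner_smul_right]
  linear_combination -(inner ℝ (P.q i) z + P.γ i) * hab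

lemma g_combo_right (i : Fin m) (x : Vec n) {a b : ℝ} (hab : a + b = 1) (z y : Vec (P.dim i)) :
    P.g i x (a • z + b • y) = a * P.g i x z + b * P.g i x y := by
  simp only [g, act_add, act_smul, inner_add_right, real_inner_smul_right]
  linear_combination -(inner ℝ (P.d i) x + P.γ i) * hab

lemma g_le_f (i : Fin m) (x : Vec n) {z : Vec (P.dim i)} (hz : z ∈ P.Z i) :
    P.g i x z ≤ P.f i x := by
  have hb : BddAbove (Set.range fun z : P.Z i => P.g i x z) := by
    have := ((P.isCompact_Z i).image (P.continuous_g i x)).bddAbove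
    rwa [Set.image_eq_range] at this
  exact le_ciSup (f := fun z : P.Z i => P.g i x z) hb ⟨z, hz⟩

lemma exists_g_eq_f (i : Fin m) (x : Vec n) : ∃ z ∈ P.Z i, P.g i x z = P.f i x := by
  obtain ⟨z, hz, hmax⟩ := (P.isCompact_Z i).exists_isMaxOn (P.nonempty_Z i)
    (P.continuous_g i x).continuousOn
  have : Nonempty (P.Z i) := ⟨⟨z, hz⟩⟩
  exact ⟨z, hz, le_antisymm (P.g_le_f i x hz) (ciSup_le fun y => hmax y.2)⟩

lemma convexOn_f (i : Fin m) : ConvexOn ℝ Set.univ (P.f i) := by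
  refine ⟨convex_univ, fun x _ y _ a b ha hb hab => ?_⟩
  obtain ⟨z, hz, e⟩ := P.exists_g_eq_f i (a • x + b • y)
  rw [← e, g_combo_left _ _ _ hab, smul_eq_mul, smul_eq_mul]
  exact add_le_add (mul_le_mul_of_nonneg_left (P.g_le_f i x hz) ha)
    (mul_le_mul_of_nonneg_left (P.g_le_f i y hz) hb)

lemma norm_le_R (i : Fin m) {z : Vec (P.dim i)} (hz : z ∈ P.Z i) : ‖z‖ ≤ P.R i := by
  have hb : BddAbove (Set.range fun z : P.Z i => ‖(z : Vec (P.dim i))‖) := by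
    have := ((P.isCompact_Z i).image continuous_norm).bddAbove
    rwa [Set.image_eq_range] at this
  exact le_ciSup (f := fun z : P.Z i => ‖(z : Vec (P.dim i))‖) hb ⟨z, hz⟩

lemma R_nonneg (i : Fin m) : 0 ≤ P.R i := by
  obtain ⟨z, hz⟩ := P.nonempty_Z i
  exact (norm_nonneg z).trans (P.norm_le_R i hz)

lemma two_le_Γ : 2 ≤ P.Γ := le_max_left _ _

lemma one_add_le_Γ (i : Fin m) : 1 + 4 * P.R i ^ 2 ≤ P.Γ :=
  (le_ciSup (f := fun i => 1 + 4 * P.R i ^ 2) (Set.finite_range _).bddAbove i).trans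
    (le_max_right _ _)

section Cone

variable {P} {i : Fin m}

lemma ray_mem_U {a : ℝ} (ha : 0 ≤ a) {z : Vec (P.dim i)} (hz : z ∈ P.Z i) :
    Lifted.ray a z ∈ P.U i := ⟨ha, Set.smul_mem_smul_set hz⟩

/-- Convexity of Z^i enters through (a + b)Z = aZ + bZ for a, b ≥ 0. -/
lemma U_add {u v : Lifted (P.dim i)} (hu : u ∈ P.U i) (hv : v ∈ P.U i) : u + v ∈ P.U i := by
  refine ⟨add_nonneg hu.1 hv.1, ?_⟩
  rw [Lifted.fst_add, Lifted.snd_add, (P.convex_Z i).add_smul hu.1 hv.1]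
  exact Set.add_mem_add hu.2 hv.2

lemma U_smul {u : Lifted (P.dim i)} (hu : u ∈ P.U i) {a : ℝ} (ha : 0 ≤ a) : a • u ∈ P.U i := by
  refine ⟨mul_nonneg ha hu.1, ?_⟩
  rw [Lifted.fst_smul, Lifted.snd_smul, mul_smul]
  exact Set.smul_mem_smul_set hu.2

lemma U_zero : (0 : Lifted (P.dim i)) ∈ P.U i := by
  obtain ⟨z, hz⟩ := P.nonempty_Z i
  simpa using U_smul (ray_mem_U zero_le_one hz) le_rfl

lemma convex_U : Convex ℝ (P.U i) := fun _ hu _ hv _ _ ha hb _ =>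
  U_add (U_smul hu ha) (U_smul hv hb)

lemma exists_fst_eq {u : Lifted (P.dim i)} (hu : u ∈ P.U i) :
    ∃ z ∈ P.Z i, u.fst = u.snd • z := by
  obtain ⟨z, hz, e⟩ := hu.2
  exact ⟨z, hz, e.symm⟩

lemma inner_dual_slope_nonpos {u : Lifted (P.dim i)} (hu : u ∈ P.U i) {x : Vec n}
    (hx : P.f i x ≤ 0) : inner ℝ (act (P.Qt i)ᵀ x + P.qt i) u ≤ 0 := by
  obtain ⟨z, hz, e⟩ := exists_fst_eq hu
  rw [P.inner_dual_slope i x e]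
  exact mul_nonpos_of_nonneg_of_nonpos hu.1 ((P.g_le_f i x hz).trans hx)

lemma norm_le_of_mem_U {u : Lifted (P.dim i)} (hu : u ∈ P.U i) :
    ‖u‖ ≤ u.snd * (P.R i + 1) := by
  obtain ⟨z, hz, e⟩ := exists_fst_eq hu
  have hs := hu.1
  have hz' := P.norm_le_R i hz
  have hR := P.R_nonneg i
  refine le_of_sq_le_sq ?_ (by positivity)
  rw [Lifted.norm_sq_eq, e, norm_smul, Real.norm_of_nonneg hs]
  have : (u.snd * ‖z‖) ^ 2 ≤ (u.snd * P.R i) ^ 2 := by gcongr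
  nlinarith [mul_nonneg (sq_nonneg u.snd) hR]

/-- Origin of Γ: with μ the maximum, the vector parts differ by at most 2R_i μ and the scalar parts,
both in [0, μ], by at most μ. -/
lemma norm_sub_sq_le_of_mem_U {u v : Lifted (P.dim i)} (hu : u ∈ P.U i) (hv : v ∈ P.U i) {M : ℝ}
    (hM : u.snd ≤ M) : ‖u - v‖ ^ 2 ≤ P.Γ * max M v.snd ^ 2 := by
  obtain ⟨z, hz, e⟩ := exists_fst_eq hu
  obtain ⟨z', hz', e'⟩ := exists_fst_eq hv
  have hu0 := hu.1
  have hv0 := hv.1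
  set μ := max M v.snd
  have hμu : u.snd ≤ μ := hM.trans (le_max_left _ _)
  have hμv : v.snd ≤ μ := le_max_right _ _
  have hμ : 0 ≤ μ := hv0.trans hμv
  have hR := P.R_nonneg i
  have h1 : ‖u.fst - v.fst‖ ≤ 2 * P.R i * μ := by
    calc ‖u.fst - v.fst‖ ≤ ‖u.fst‖ + ‖v.fst‖ := norm_sub_le _ _
      _ = u.snd * ‖z‖ + v.snd * ‖z'‖ := by
        rw [e, e', norm_smul, norm_smul, Real.norm_of_nonneg hu0, Real.norm_of_nonneg hv0]
      _ ≤ μ * P.R i + μ * P.R i := by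
        gcongr
        · exact P.norm_le_R i hz
        · exact P.norm_le_R i hz'
      _ = 2 * P.R i * μ := by ring
  have h2 : (u.snd - v.snd) ^ 2 ≤ μ ^ 2 := by
    refine sq_le_sq' ?_ ?_ <;> linarith
  calc ‖u - v‖ ^ 2 = ‖u.fst - v.fst‖ ^ 2 + (u.snd - v.snd) ^ 2 := by
        rw [Lifted.norm_sq_eq, Lifted.fst_sub, Lifted.snd_sub]
    _ ≤ (2 * P.R i * μ) ^ 2 + μ ^ 2 := by gcongr
    _ = (1 + 4 * P.R i ^ 2) * μ ^ 2 := by ring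
    _ ≤ P.Γ * μ ^ 2 := by gcongr; exact P.one_add_le_Γ i

end Cone

/-- Strong duality for the robust problem, with the inner maximization resolved by worst-case
parameters. -/
lemma exists_dual (hA : LinearIndependent ℝ P.A.row) {xstar : Vec n} (hopt : P.IsOptimal xstar)
    {xhat : Vec n} {ε : ℝ} (hs : P.IsSlater xhat ε) :
    ∃ (lam : Fin m → ℝ) (z : (i : Fin m) → Vec (P.dim i)) (w : Vec r),
      (∀ i, 0 ≤ lam i) ∧ (∀ i, z i ∈ P.Z i) ∧ ∀ x ∈ P.X, inner ℝ P.c xstar ≤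
        inner ℝ P.c x + ∑ i, lam i * P.g i x (z i) + inner ℝ w (act P.A x - P.b) := by
  obtain ⟨hint, hAx, hε, hball⟩ := hs
  have hneg : ∀ i, P.f i xhat < 0 := by simpa using (hball 0 (by simpa using hε.le)).2
  obtain ⟨lam, w, hlam, hL⟩ := exists_lagrange_multipliers P.convex_X
    (f₀ := fun x => inner ℝ P.c x) ⟨convex_univ, fun x _ y _ a b _ _ _ => by
      simp [inner_add_right, real_inner_smul_right]⟩ P.convexOn_f
    (Matrix.toEuclideanLin P.A) (act_surjective hA) hint hAx hneg
    (c := inner ℝ P.c xstar) fun x hx hf hAx => hopt.2 x ⟨hx, hf, hAx⟩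
  let h : ((i : Fin m) → Vec (P.dim i)) → Vec n → ℝ := fun z x =>
    inner ℝ P.c x + ∑ i, lam i * P.g i x (z i) + inner ℝ w (act P.A x - P.b)
  have hact : Continuous fun x => act P.A x :=
    (Matrix.toEuclideanLin P.A).continuous_of_finiteDimensional
  have hcx : ∀ z, Continuous (h z) := by
    intro z
    unfold h g
    fun_prop
  have hcz : ∀ x, Continuous fun z => h z x := by
    intro x
    have := fun i => P.continuous_g i x
    unfold h
    fun_prop
  have hx' : ∀ z, ∀ x y : Vec n, ∀ a b : ℝ, a + b = 1 →
      h z (a • x + b • y) = a • h z x + b • h z y := by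
    intro z x y a b hab
    have e : ∑ i, lam i * P.g i (a • x + b • y) (z i)
        = a * (∑ i, lam i * P.g i x (z i)) + b * (∑ i, lam i * P.g i y (z i)) := by
      rw [Finset.mul_sum, Finset.mul_sum, ← Finset.sum_add_distrib]
      exact Finset.sum_congr rfl fun i _ => by rw [P.g_combo_left _ _ hab]; ring
    simp only [h, e, act_add, act_smul, inner_add_right, inner_sub_right, real_inner_smul_right,
      smul_eq_mul]
    linear_combination inner ℝ w P.b * hab
  have hz' : ∀ x, ∀ z y : (i : Fin m) → Vec (P.dim i), ∀ a b : ℝ, a + b = 1 →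
      h (a • z + b • y) x = a • h z x + b • h y x := by
    intro x z y a b hab
    have e : ∑ i, lam i * P.g i x ((a • z + b • y) i)
        = a * (∑ i, lam i * P.g i x (z i)) + b * (∑ i, lam i * P.g i x (y i)) := by
      rw [Finset.mul_sum, Finset.mul_sum, ← Finset.sum_add_distrib]
      exact Finset.sum_congr rfl fun i _ => by
        rw [Pi.add_apply, Pi.smul_apply, Pi.smul_apply, P.g_combo_right _ _ hab]; ring
    simp only [h, e, smul_eq_mul]
    linear_combination -(inner ℝ P.c x + inner ℝ w (act P.A x - P.b)) * hab
  have hZconv : Convex ℝ (Set.univ.pi P.Z) := convex_pi fun i _ => P.convex_Z i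
  -- The function h is affine in each argument and the product of the Z^i is compact, so one choice
  -- of z serves all x at once.
  obtain ⟨z, hz, hzmin⟩ := exists_forall_le_of_forall_exists_le (Z := Set.univ.pi P.Z)
    (Y := interior P.X) (h := h) (c := inner ℝ P.c xstar)
    (Set.univ_pi_nonempty_iff.2 P.nonempty_Z) hZconv (isCompact_univ_pi P.isCompact_Z)
    P.convex_X.interior (fun x _ => (hcz x).continuousOn)
    (fun x _ => ⟨hZconv, fun z _ y _ a b _ _ hab => (hz' x z y a b hab).ge⟩)
    (fun z _ => (hcx z).continuousOn)
    (fun z _ => ⟨P.convex_X.interior, fun x _ y _ a b _ _ hab => (hx' z x y a b hab).le⟩)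
    (fun x hx => by
      choose z hz hzf using fun i => P.exists_g_eq_f i x
      refine ⟨z, fun i _ => hz i, ?_⟩
      simp only [h, hzf]
      exact hL x hx)
  refine ⟨lam, z, w, hlam, fun i => hz i trivial, fun x hx => ?_⟩
  -- The inequality is known on the interior of X and extends to X by continuity.
  have hcl : P.X ⊆ closure (interior P.X) := by
    rw [P.convex_X.closure_interior_eq_closure_of_nonempty_interior ⟨_, hint⟩]
    exact subset_closure
  exact closure_minimal (t := {x | inner ℝ P.c xstar ≤ h z x}) hzmin
    (isClosed_le continuous_const (hcx z)) (hcl hx)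

/-- The Lagrangian at `x` and `(u, w, π)`, where `s` replaces `σ_X(π)`. -/
def lag (x : Vec n) (u : (i : Fin m) → Lifted (P.dim i)) (w : Vec r) (π : Vec n) (s : ℝ) : ℝ :=
  inner ℝ (P.c + P.Qy u w π) x + ∑ i, inner ℝ (P.qt i) (u i) - inner ℝ w P.b - s

lemma lag_eq (x : Vec n) (u : (i : Fin m) → Lifted (P.dim i)) (w : Vec r) (π : Vec n) (s : ℝ) :
    P.lag x u w π s = inner ℝ P.c x + ∑ i, inner ℝ (act (P.Qt i)ᵀ x + P.qt i) (u i)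
      + inner ℝ w (act P.A x - P.b) + inner ℝ π x - s := by
  have h1 : inner ℝ (act P.Aᵀ w) x = inner ℝ w (act P.A x) := inner_act_transpose _ _ _
  have h2 : ∀ i, inner ℝ (act (P.Qt i)ᵀ x) (u i) = inner ℝ (act (P.Qt i) (u i)) x := fun i => by
    rw [inner_act_transpose, real_inner_comm]
  simp only [lag, Qy, inner_add_left, inner_sub_right, sum_inner, h1, h2, Finset.sum_add_distrib]
  ring

end Problem

/-! ### A dual solution with explicit bounds. -/

namespace Problem

variable {n m r : ℕ} (P : Problem n m r)

lemma IsSlater.neg {P : Problem n m r} {xhat : Vec n} {ε : ℝ} (hs : P.IsSlater xhat ε)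
    (i : Fin m) : P.f i xhat < 0 := by
  simpa using (hs.2.2.2 0 (by simpa using hs.2.2.1.le)).2 i

lemma IsSlater.lt_inner {P : Problem n m r} {xhat : Vec n} {ε : ℝ} (hs : P.IsSlater xhat ε)
    {xstar : Vec n} (hopt : P.IsOptimal xstar) {v : ℝ} (hv : v < inner ℝ P.c xstar) :
    v < inner ℝ P.c xhat :=
  hv.trans_le (hopt.2 xhat ⟨interior_subset hs.1, fun i => (hs.neg i).le, hs.2.1⟩)

lemma le_lamBar {xhat : Vec n} {v : ℝ} {lam : Fin m → ℝ} (hlam : ∀ i, 0 ≤ lam i)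
    (hneg : ∀ i, P.f i xhat < 0)
    (h : ∑ i, lam i * -P.f i xhat ≤ inner ℝ P.c xhat - v) (i : Fin m) :
    lam i ≤ P.lamBar xhat v := by
  have : Nonempty (Fin m) := ⟨i⟩
  obtain ⟨j, hj⟩ := exists_eq_ciSup_of_finite (f := fun i => P.f i xhat)
  have hle : P.f i xhat ≤ ⨆ i, P.f i xhat :=
    le_ciSup (f := fun i => P.f i xhat) (Set.finite_range _).bddAbove i
  have hsup : (⨆ i, P.f i xhat) < 0 := hj ▸ hneg j
  rw [lamBar, le_div_iff₀ (by linarith)]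
  calc lam i * -(⨆ i, P.f i xhat) ≤ lam i * -P.f i xhat :=
        mul_le_mul_of_nonneg_left (neg_le_neg hle) (hlam i)
    _ ≤ ∑ i, lam i * -P.f i xhat :=
        Finset.single_le_sum (f := fun i => lam i * -P.f i xhat)
          (fun j _ => mul_nonneg (hlam j) (by linarith [hneg j])) (Finset.mem_univ i)
    _ ≤ _ := h

lemma lamBar_nonneg {xhat : Vec n} {v : ℝ} (hneg : ∀ i, P.f i xhat < 0)
    (hv : v < inner ℝ P.c xhat) : 0 ≤ P.lamBar xhat v :=
  div_nonneg (by linarith) (neg_nonneg.2 (Real.iSup_nonpos fun i => (hneg i).le))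

lemma norm_le_Rw (hA : LinearIndependent ℝ P.A.row) {xhat : Vec n} {ε v : ℝ} {w : Vec r}
    (h : ‖act P.Aᵀ w‖ ≤ (inner ℝ P.c xhat - v) / ε + ‖P.c‖) : ‖w‖ ≤ P.Rw xhat ε v := by
  rcases Nat.eq_zero_or_pos r with rfl | hr
  · have e : w = 0 := Subsingleton.elim _ _
    rw [e, norm_zero]
    exact mul_nonneg (one_div_nonneg.2 P.sigmaMin_nonneg) ((norm_nonneg _).trans h)
  · have := P.sigmaMin_pos hA hr
    rw [Rw, one_div, inv_mul_eq_div, le_div_iff₀ this, mul_comm]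
    exact (P.sigmaMin_mul_norm_le w).trans h

/-- A dual optimal solution within the bounds `λ̄`, `R_w` and `R_π`. -/
lemma exists_bounded_dual (hA : LinearIndependent ℝ P.A.row) {xstar : Vec n}
    (hopt : P.IsOptimal xstar) {xhat : Vec n} {ε : ℝ} (hs : P.IsSlater xhat ε) {v : ℝ}
    (hv : v < inner ℝ P.c xstar) :
    ∃ (u : (i : Fin m) → Lifted (P.dim i)) (w : Vec r) (π : Vec n) (s : ℝ),
      (∀ i, u i ∈ P.U i) ∧ (∀ i, (u i).snd ≤ P.lamBar xhat v) ∧ ‖w‖ ≤ P.Rw xhat ε v ∧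
      ‖π‖ ≤ P.Rπ xhat ε v ∧ (∀ x ∈ P.X, inner ℝ π x ≤ s) ∧
      ∀ x, P.lag x u w π s = inner ℝ P.c xstar := by
  obtain ⟨lam, z, w, hlam, hz, hL⟩ := P.exists_dual hA hopt hs
  have hneg := hs.neg
  obtain ⟨hint, hAx, hε, hball⟩ := id hs
  have hvx := hs.lt_inner hopt hv
  have hlamBar : ∀ i, lam i ≤ P.lamBar xhat v := by
    refine P.le_lamBar hlam hneg ?_
    have h1 := hL xhat (interior_subset hint)
    rw [hAx, sub_self, inner_zero_right] at h1
    have h2 : ∑ i, lam i * P.g i xhat (z i) ≤ ∑ i, lam i * P.f i xhat :=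
      Finset.sum_le_sum fun i _ => mul_le_mul_of_nonneg_left (P.g_le_f i _ (hz i)) (hlam i)
    simp only [mul_neg, Finset.sum_neg_distrib]
    linarith
  have hATw : ‖act P.Aᵀ w‖ ≤ (inner ℝ P.c xhat - v) / ε + ‖P.c‖ := by
    set a := act P.Aᵀ w
    rcases eq_or_ne a 0 with h0 | h0
    · rw [h0, norm_zero]
      exact add_nonneg (div_nonneg (by linarith) hε.le) (norm_nonneg _)
    have ha : 0 < ‖a‖ := norm_pos_iff.2 h0
    -- The point of the Slater ball that makes wᵀA y smallest, namely −ε‖Aᵀw‖.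
    set y : Vec n := -((ε / ‖a‖) • a)
    have hy : ‖y‖ = ε := by
      rw [norm_neg, norm_smul, Real.norm_of_nonneg (by positivity), div_mul_cancel₀ _ ha.ne']
    obtain ⟨hX, hf⟩ := hball y hy.le
    have h1 := hL _ hX
    have h2 : ∑ i, lam i * P.g i (xhat + y) (z i) ≤ 0 := Finset.sum_nonpos fun i _ =>
      mul_nonpos_of_nonneg_of_nonpos (hlam i) ((P.g_le_f i _ (hz i)).trans (hf i).le)
    have h3 : inner ℝ w (act P.A (xhat + y) - P.b) = -(ε * ‖a‖) := by
      rw [act_add, hAx, add_sub_cancel_left, ← inner_act_transpose]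
      change inner ℝ a y = _
      rw [inner_neg_right, real_inner_smul_right, real_inner_self_eq_norm_sq]
      field_simp
    have h4 : inner ℝ P.c y ≤ ‖P.c‖ * ε := hy ▸ real_inner_le_norm _ _
    rw [h3, inner_add_right] at h1
    have h5 : ‖a‖ * ε ≤ (inner ℝ P.c xhat - v) + ‖P.c‖ * ε := by linarith
    have h6 : ‖a‖ ≤ ((inner ℝ P.c xhat - v) + ‖P.c‖ * ε) / ε := (le_div_iff₀ hε).2 h5
    rwa [add_div, mul_div_cancel_right₀ _ hε.ne'] at h6
  have hw := P.norm_le_Rw hA hATw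
  set u : (i : Fin m) → Lifted (P.dim i) := fun i => Lifted.ray (lam i) (z i)
  have hu : ∀ i, u i ∈ P.U i := fun i => ray_mem_U (hlam i) (hz i)
  -- This choice gives c + Q̄y = 0, so the Lagrangian is constant in x; s then sets the constant to
  -- cᵀx*. That s bounds πᵀx on X is precisely the dual inequality `hL`.
  set π : Vec n := -(P.c + (∑ i, act (P.Qt i) (u i)) + act P.Aᵀ w)
  set s : ℝ := ∑ i, inner ℝ (P.qt i) (u i) - inner ℝ w P.b - inner ℝ P.c xstar
  have hlag : ∀ x, P.lag x u w π s = inner ℝ P.c xstar := by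
    intro x
    have : P.c + P.Qy u w π = 0 := by simp only [Qy, π]; abel
    rw [lag, this, inner_zero_left]
    simp only [s]
    ring
  refine ⟨u, w, π, s, hu, hlamBar, hw, ?_, fun x hx => ?_, hlag⟩
  · have hlb := P.lamBar_nonneg hneg hvx
    calc ‖π‖ ≤ ‖P.c‖ + ‖∑ i, act (P.Qt i) (u i)‖ + ‖act P.Aᵀ w‖ := by
          rw [norm_neg]; exact norm_add₃_le
      _ ≤ ‖P.c‖ + ∑ i, P.lamBar xhat v * (‖P.Qt i‖ * (P.R i + 1)) + ‖P.A‖ * P.Rw xhat ε v := by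
          gcongr
          · refine norm_sum_le_of_le _ fun i _ => ?_
            have hR := P.R_nonneg i
            calc ‖act (P.Qt i) (u i)‖ ≤ ‖P.Qt i‖ * ‖u i‖ := norm_act_le _ _
              _ ≤ ‖P.Qt i‖ * (lam i * (P.R i + 1)) := by
                gcongr; exact norm_le_of_mem_U (hu i)
              _ ≤ ‖P.Qt i‖ * (P.lamBar xhat v * (P.R i + 1)) := by
                gcongr; exact hlamBar i
              _ = _ := by ring
          · refine (norm_act_le _ _).trans ?_
            rw [norm_transpose]
            gcongr
      _ = P.Rπ xhat ε v := by rw [Rπ, Finset.mul_sum]; ring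
  · have h1 := hlag x
    have h2 := hL x hx
    rw [lag_eq] at h1
    have h3 : ∑ i, inner ℝ (act (P.Qt i)ᵀ x + P.qt i) (u i) = ∑ i, lam i * P.g i x (z i) :=
      Finset.sum_congr rfl fun i _ => P.inner_dual_slope i x rfl
    rw [h3] at h1
    linarith

/-! ### Descent of the Lyapunov function and the ergodic gap. -/

lemma Qy_sub (u u' : (i : Fin m) → Lifted (P.dim i)) (w w' : Vec r) (π π' : Vec n) :
    P.Qy u w π - P.Qy u' w' π' = P.Qy (u - u') (w - w') (π - π') := by
  simp only [Qy, Pi.sub_apply, act_sub, Finset.sum_sub_distrib]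
  abel

lemma two_mul_inner_sub_sub {E : Type*} [NormedAddCommGroup E] [InnerProductSpace ℝ E]
    (a b c : E) :
    2 * inner ℝ (b - a) (c - b) = ‖c - a‖ ^ 2 - ‖c - b‖ ^ 2 - ‖b - a‖ ^ 2 := by
  rw [show c - a = (c - b) + (b - a) by abel, norm_add_sq_real, real_inner_comm]
  ring

variable {P}

/-- One step of the method decreases the Lyapunov function by twice the primal-dual gap. -/
lemma IsPAPC.two_mul_gap_le {τ : ℝ} (hτ : 0 < τ) {θ : Fin m → ℝ} (hθ : ∀ i, 0 < θ i)
    {θw : ℝ} (hθw : 0 < θw) {θπ : ℝ} (hθπ : 0 < θπ) (hH : (P.H τ θ θw θπ).PosDef)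
    {x : ℕ → Vec n} {u : ℕ → (i : Fin m) → Lifted (P.dim i)} {w : ℕ → Vec r} {π : ℕ → Vec n}
    (h : P.IsPAPC τ θ θw θπ x u w π) {xstar : Vec n} (hfeas : xstar ∈ P.feasible)
    {u' : (i : Fin m) → Lifted (P.dim i)} (hu' : ∀ i, u' i ∈ P.U i) (w' : Vec r) {π' : Vec n}
    {s : ℝ} (hs : ∀ y ∈ P.X, inner ℝ π' y ≤ s) (k : ℕ) :
    2 * (P.lag (x (k + 1)) u' w' π' s - inner ℝ P.c xstar) ≤
      (‖xstar - x k‖ ^ 2 / τ + P.quad τ θ θw θπ (u' - u k) (w' - w k) (π' - π k)) -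
      (‖xstar - x (k + 1)‖ ^ 2 / τ
        + P.quad τ θ θw θπ (u' - u (k + 1)) (w' - w (k + 1)) (π' - π (k + 1))) := by
  obtain ⟨hxX, hf, hAx⟩ := hfeas
  set p := P.predictor τ (x k) (u k) (w k) (π k) with hp
  set x₁ := x (k + 1)
  set u₁ := u (k + 1)
  set w₁ := w (k + 1)
  set π₁ := π (k + 1)
  have hu₁ : ∀ i, u₁ i ∈ P.U i := fun i => (h.u_step k i).1
  obtain ⟨s₁, hs₁, hprox⟩ := (h.π_step k).exists_inner_le ⟨_, hxX⟩ hθπ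
  have hx₁ : x₁ = x k - τ • (P.c + P.Qy u₁ w₁ π₁) := h.x_step k
  have hw₁ : w₁ = w k + θw • (act P.A p - P.b) := h.w_step k
  -- feasibility of `xstar`
  have e0 : P.lag xstar u₁ w₁ π₁ s₁ ≤ inner ℝ P.c xstar := by
    rw [lag_eq, hAx, sub_self, inner_zero_right]
    have := Finset.sum_nonpos fun i (_ : i ∈ Finset.univ) => inner_dual_slope_nonpos (hu₁ i) (hf i)
    have := hs₁ _ hxX
    linarith
  -- the primal step
  have e1 : inner ℝ (P.c + P.Qy u₁ w₁ π₁) (x₁ - xstar)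
      = (‖xstar - x k‖ ^ 2 - ‖xstar - x₁‖ ^ 2 - ‖x₁ - x k‖ ^ 2) / (2 * τ) := by
    rw [← two_mul_inner_sub_sub, show x₁ - x k = -(τ • (P.c + P.Qy u₁ w₁ π₁)) by rw [hx₁]; abel,
      inner_neg_left, real_inner_smul_left, ← neg_sub x₁ xstar, inner_neg_right]
    field_simp
  -- the dual steps
  have e2 : ∀ i, inner ℝ (act (P.Qt i)ᵀ p + P.qt i) (u' i - u₁ i) ≤
      (‖u' i - u k i‖ ^ 2 - ‖u' i - u₁ i‖ ^ 2 - ‖u₁ i - u k i‖ ^ 2) / (2 * θ i) := by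
    intro i
    have := (h.u_step k i).inner_sub_sub_nonpos convex_U (hu' i)
    rw [← hp, add_sub_right_comm, inner_add_left, real_inner_smul_left, ← neg_sub (u₁ i),
      inner_neg_left] at this
    rw [← two_mul_inner_sub_sub, mul_div_mul_left _ _ two_ne_zero, le_div_iff₀ (hθ i)]
    linarith
  have e3 : inner ℝ (act P.A p - P.b) (w' - w₁)
      = (‖w' - w k‖ ^ 2 - ‖w' - w₁‖ ^ 2 - ‖w₁ - w k‖ ^ 2) / (2 * θw) := by
    rw [← two_mul_inner_sub_sub, mul_div_mul_left _ _ two_ne_zero,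
      show w₁ - w k = θw • (act P.A p - P.b) by rw [hw₁]; abel, real_inner_smul_left,
      mul_div_cancel_left₀ _ hθw.ne']
  have e4 : inner ℝ p (π' - π₁) - (s - s₁) ≤
      (‖π' - π k‖ ^ 2 - ‖π' - π₁‖ ^ 2 - ‖π₁ - π k‖ ^ 2) / (2 * θπ) := by
    have := hprox π' s hs
    rw [← hp, add_sub_right_comm, inner_add_left, real_inner_smul_left, ← neg_sub π₁,
      inner_neg_left] at this
    rw [← two_mul_inner_sub_sub, mul_div_mul_left _ _ two_ne_zero, le_div_iff₀ hθπ]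
    linarith
  -- the predictor error
  have e5 : inner ℝ (P.Qy (u' - u₁) (w' - w₁) (π' - π₁)) (x₁ - p)
      = -(τ / 2) * (‖P.Qy (u' - u k) (w' - w k) (π' - π k)‖ ^ 2
        - ‖P.Qy (u' - u₁) (w' - w₁) (π' - π₁)‖ ^ 2
        - ‖P.Qy (u₁ - u k) (w₁ - w k) (π₁ - π k)‖ ^ 2) := by
    simp only [← Qy_sub]
    rw [← two_mul_inner_sub_sub,
      show x₁ - p = -(τ • (P.Qy u₁ w₁ π₁ - P.Qy (u k) (w k) (π k))) by
        rw [hx₁, hp, predictor, ← sub_eq_zero]; module,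
      inner_neg_right, real_inner_smul_right, real_inner_comm]
    ring
  have e6 : inner ℝ (P.Qy (u' - u₁) (w' - w₁) (π' - π₁)) p
      + ∑ i, inner ℝ (P.qt i) ((u' - u₁) i) - inner ℝ (w' - w₁) P.b
      = ∑ i, inner ℝ (act (P.Qt i)ᵀ p + P.qt i) (u' i - u₁ i)
        + inner ℝ (act P.A p - P.b) (w' - w₁) + inner ℝ p (π' - π₁) := by
    have e := P.lag_eq p (u' - u₁) (w' - w₁) (π' - π₁) 0
    rw [lag, inner_add_left] at e
    simp only [Pi.sub_apply] at e ⊢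
    rw [real_inner_comm (w' - w₁), real_inner_comm (π' - π₁)]
    linarith
  -- The gap splits into the primal step, the mismatch between x₁ and the predictor p, and the dual
  -- steps, which were taken at p.
  have e7 : P.lag x₁ u' w' π' s - P.lag xstar u₁ w₁ π₁ s₁
      = inner ℝ (P.c + P.Qy u₁ w₁ π₁) (x₁ - xstar)
        + inner ℝ (P.Qy (u' - u₁) (w' - w₁) (π' - π₁)) (x₁ - p)
        + (inner ℝ (P.Qy (u' - u₁) (w' - w₁) (π' - π₁)) p
          + ∑ i, inner ℝ (P.qt i) ((u' - u₁) i) - inner ℝ (w' - w₁) P.b) - (s - s₁) := by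
    simp only [lag, ← Qy_sub, Pi.sub_apply, inner_sub_left, inner_sub_right, inner_add_left,
      Finset.sum_sub_distrib]
    ring
  -- The squared dual increments from `e2`, `e3`, `e4` and the last square in `e5` combine to the
  -- H-norm of the dual step, which positive definiteness allows to be dropped.
  have e8 := P.quad_nonneg hH (u₁ - u k) (w₁ - w k) (π₁ - π k)
  have e9 := Finset.sum_le_sum fun i (_ : i ∈ Finset.univ) => e2 i
  have e10 : ∑ i, (‖u' i - u k i‖ ^ 2 - ‖u' i - u₁ i‖ ^ 2 - ‖u₁ i - u k i‖ ^ 2) / (2 * θ i)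
      = (∑ i, ‖u' i - u k i‖ ^ 2 / θ i - ∑ i, ‖u' i - u₁ i‖ ^ 2 / θ i
        - ∑ i, ‖u₁ i - u k i‖ ^ 2 / θ i) / 2 := by
    rw [← Finset.sum_sub_distrib, ← Finset.sum_sub_distrib, Finset.sum_div]
    refine Finset.sum_congr rfl fun i _ => ?_
    field_simp
  have half : ∀ a b c t : ℝ, (a - b - c) / (2 * t) = (a / t - b / t - c / t) / 2 := by
    intro a b c t; ring
  rw [e10] at e9
  rw [half] at e1 e3 e4
  have e11 : 0 ≤ ‖x₁ - x k‖ ^ 2 / τ := by positivity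
  simp only [quad, Pi.sub_apply] at e8 ⊢
  linarith

/-- The ergodic primal-dual gap bound. -/
lemma IsPAPC.ergodic_gap_le {τ : ℝ} (hτ : 0 < τ) {θ : Fin m → ℝ} (hθ : ∀ i, 0 < θ i)
    {θw : ℝ} (hθw : 0 < θw) {θπ : ℝ} (hθπ : 0 < θπ) (hH : (P.H τ θ θw θπ).PosDef)
    {x : ℕ → Vec n} {u : ℕ → (i : Fin m) → Lifted (P.dim i)} {w : ℕ → Vec r} {π : ℕ → Vec n}
    (h : P.IsPAPC τ θ θw θπ x u w π) {xstar : Vec n} (hfeas : xstar ∈ P.feasible)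
    {u' : (i : Fin m) → Lifted (P.dim i)} (hu' : ∀ i, u' i ∈ P.U i) (w' : Vec r) {π' : Vec n}
    {s : ℝ} (hs : ∀ y ∈ P.X, inner ℝ π' y ≤ s) {N : ℕ} (hN : 1 ≤ N) :
    2 * N * (P.lag (ergodic x N) u' w' π' s - inner ℝ P.c xstar) ≤
      ‖xstar - x 0‖ ^ 2 / τ + (∑ i, ‖u' i - u 0 i‖ ^ 2 / θ i + ‖w' - w 0‖ ^ 2 / θw
        + ‖π' - π 0‖ ^ 2 / θπ) := by
  set E : ℕ → ℝ := fun k => ‖xstar - x k‖ ^ 2 / τ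
    + P.quad τ θ θw θπ (u' - u k) (w' - w k) (π' - π k) with hE
  have hN0 : (N : ℝ) ≠ 0 := by positivity
  have h1 : ∑ k ∈ Finset.range N, 2 * (P.lag (x (k + 1)) u' w' π' s - inner ℝ P.c xstar)
      ≤ E 0 - E N := by
    rw [← Finset.sum_range_sub']
    exact Finset.sum_le_sum fun k _ => h.two_mul_gap_le hτ hθ hθw hθπ hH hfeas hu' w' hs k
  have h2 : ∑ k ∈ Finset.range N, 2 * (P.lag (x (k + 1)) u' w' π' s - inner ℝ P.c xstar)
      = 2 * N * (P.lag (ergodic x N) u' w' π' s - inner ℝ P.c xstar) := by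
    -- Affinity in x makes the average of the gaps equal to the gap at the average, with no loss.
    have e : ∑ k ∈ Finset.range N, inner ℝ (P.c + P.Qy u' w' π') (x (k + 1))
        = N * inner ℝ (P.c + P.Qy u' w' π') (ergodic x N) := by
      rw [ergodic, real_inner_smul_right, inner_sum, Finset.range_eq_Ico,
        Finset.sum_Ico_add' (fun k => inner ℝ (P.c + P.Qy u' w' π') (x k)) 0 N 1, zero_add,
        Finset.Ico_add_one_right_eq_Icc]
      field_simp
    simp only [lag, ← Finset.mul_sum, Finset.sum_sub_distrib, Finset.sum_add_distrib, e,
      Finset.sum_const, Finset.card_range, nsmul_eq_mul]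
    ring
  have h3 : 0 ≤ E N := add_nonneg (by positivity) (P.quad_nonneg hH _ _ _)
  have h4 : E 0 ≤ ‖xstar - x 0‖ ^ 2 / τ + (∑ i, ‖u' i - u 0 i‖ ^ 2 / θ i + ‖w' - w 0‖ ^ 2 / θw
      + ‖π' - π 0‖ ^ 2 / θπ) := by
    -- The H-norm is at most the S-norm.
    have : 0 ≤ τ * ‖P.Qy (u' - u 0) (w' - w 0) (π' - π 0)‖ ^ 2 := by positivity
    simp only [hE, quad, Pi.sub_apply] at this ⊢
    linarith
  linarith

/-- The ergodic gap bound for dual points within given bounds. -/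
lemma IsPAPC.ergodic_gap_le_of_bounds {τ : ℝ} (hτ : 0 < τ) {θ : Fin m → ℝ} (hθ : ∀ i, 0 < θ i)
    {θw : ℝ} (hθw : 0 < θw) {θπ : ℝ} (hθπ : 0 < θπ) (hH : (P.H τ θ θw θπ).PosDef)
    {x : ℕ → Vec n} {u : ℕ → (i : Fin m) → Lifted (P.dim i)} {w : ℕ → Vec r} {π : ℕ → Vec n}
    (h : P.IsPAPC τ θ θw θπ x u w π) {xstar : Vec n} (hfeas : xstar ∈ P.feasible)
    {u' : (i : Fin m) → Lifted (P.dim i)} (hu' : ∀ i, u' i ∈ P.U i) {w' : Vec r} {π' : Vec n}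
    {s : ℝ} (hs : ∀ y ∈ P.X, inner ℝ π' y ≤ s) {N : ℕ} (hN : 1 ≤ N) {M W B : ℝ}
    (hM : ∀ i, (u' i).snd ≤ M) (hW : ‖w'‖ ≤ W) (hB : ‖π'‖ ≤ B) :
    P.lag (ergodic x N) u' w' π' s - inner ℝ P.c xstar ≤
      P.Γ / (2 * N) * (‖xstar - x 0‖ ^ 2 / τ + ∑ i, max M (u 0 i).snd ^ 2 / θ i
        + (‖π 0‖ ^ 2 + B ^ 2) / θπ) + (W + ‖w 0‖) ^ 2 / (2 * N * θw) := by
  have hgap := h.ergodic_gap_le hτ hθ hθw hθπ hH hfeas hu' w' hs hN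
  have hNpos : (0 : ℝ) < 2 * N := by positivity
  have hΓ := P.two_le_Γ
  have hx : ‖xstar - x 0‖ ^ 2 / τ ≤ P.Γ * (‖xstar - x 0‖ ^ 2 / τ) :=
    le_mul_of_one_le_left (by positivity) (by linarith)
  have hu : ∑ i, ‖u' i - u 0 i‖ ^ 2 / θ i ≤ P.Γ * ∑ i, max M (u 0 i).snd ^ 2 / θ i := by
    rw [Finset.mul_sum]
    refine Finset.sum_le_sum fun i _ => ?_
    rw [← mul_div_assoc]
    exact div_le_div_of_nonneg_right (norm_sub_sq_le_of_mem_U (hu' i) (h.u_init i) (hM i))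
      (hθ i).le
  have hw : ‖w' - w 0‖ ^ 2 / θw ≤ (W + ‖w 0‖) ^ 2 / θw := by
    gcongr
    exact (norm_sub_le _ _).trans (by gcongr)
  have hπ : ‖π' - π 0‖ ^ 2 / θπ ≤ P.Γ * ((‖π 0‖ ^ 2 + B ^ 2) / θπ) := by
    rw [← mul_div_assoc]
    gcongr
    have h1 : ‖π' - π 0‖ ^ 2 ≤ (‖π'‖ + ‖π 0‖) ^ 2 := by gcongr; exact norm_sub_le _ _
    have h2 : ‖π'‖ ^ 2 ≤ B ^ 2 := by gcongr
    have h3 : 2 * (‖π 0‖ ^ 2 + B ^ 2) ≤ P.Γ * (‖π 0‖ ^ 2 + B ^ 2) := by gcongr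
    nlinarith [sq_nonneg (‖π'‖ - ‖π 0‖)]
  have e : P.Γ / (2 * N) * (‖xstar - x 0‖ ^ 2 / τ + ∑ i, max M (u 0 i).snd ^ 2 / θ i
        + (‖π 0‖ ^ 2 + B ^ 2) / θπ) + (W + ‖w 0‖) ^ 2 / (2 * N * θw)
      = (P.Γ * (‖xstar - x 0‖ ^ 2 / τ) + P.Γ * (∑ i, max M (u 0 i).snd ^ 2 / θ i)
        + P.Γ * ((‖π 0‖ ^ 2 + B ^ 2) / θπ) + (W + ‖w 0‖) ^ 2 / θw) / (2 * N) := by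
    field_simp
  rw [e, le_div_iff₀ hNpos]
  linarith

/-! ### Dual test points. -/

variable (P)

lemma lag_add (x : Vec n) (u u' : (i : Fin m) → Lifted (P.dim i)) (w w' : Vec r) (π π' : Vec n)
    (s s' : ℝ) : P.lag x (u + u') (w + w') (π + π') (s + s')
      = P.lag x u w π s + P.lag x u' w' π' s' - inner ℝ P.c x := by
  simp only [lag_eq, Pi.add_apply, inner_add_right, inner_add_left, Finset.sum_add_distrib]
  ring

lemma lag_smul (x : Vec n) (a : ℝ) (u : (i : Fin m) → Lifted (P.dim i)) (w : Vec r) (π : Vec n)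
    (s : ℝ) : P.lag x (a • u) (a • w) (a • π) (a * s)
      = a * P.lag x u w π s + (1 - a) * inner ℝ P.c x := by
  simp only [lag_eq, Pi.smul_apply, real_inner_smul_right, real_inner_smul_left,
    ← Finset.mul_sum]
  ring

/-- A dual direction that detects the violation of the constraints at `x`. -/
lemma exists_violation_direction (hne : P.X.Nonempty) (x : Vec n) {α : ℝ} (hα : 0 < α) :
    ∃ (u : (i : Fin m) → Lifted (P.dim i)) (w : Vec r) (π : Vec n) (s : ℝ),
      (∀ i, u i ∈ P.U i) ∧ (∀ i, (u i).snd ≤ 1) ∧ ‖w‖ ≤ 1 ∧ ‖π‖ ≤ α ∧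
      (∀ y ∈ P.X, inner ℝ π y ≤ s) ∧
      P.lag x u w π s = inner ℝ P.c x + ((∑ i, max (P.f i x) 0) + ‖act P.A x - P.b‖
        + α * Metric.infDist x P.X) := by
  have hu : ∀ i, ∃ u ∈ P.U i, u.snd ≤ 1 ∧
      inner ℝ (act (P.Qt i)ᵀ x + P.qt i) u = max (P.f i x) 0 := by
    intro i
    rcases le_total (P.f i x) 0 with hi | hi
    · exact ⟨0, U_zero, by simp [Lifted.snd_zero], by simp [hi]⟩
    · obtain ⟨z, hz, e⟩ := P.exists_g_eq_f i x
      refine ⟨Lifted.ray 1 z, ray_mem_U zero_le_one hz, le_rfl, ?_⟩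
      rw [P.inner_dual_slope i x rfl, Lifted.snd_ray, one_mul, e, max_eq_left hi]
  choose u hu hu1 hue using hu
  obtain ⟨e, he, hex⟩ := exists_normal_infDist hne P.isClosed_X P.convex_X x
  refine ⟨u, ‖act P.A x - P.b‖⁻¹ • (act P.A x - P.b), α • e,
    α * (inner ℝ e x - Metric.infDist x P.X), hu, hu1, ?_, ?_, fun y hy => ?_, ?_⟩
  -- For a zero residual the inverse is 0, so w = 0 and the bound still holds.
  · rw [norm_smul, norm_inv, norm_norm]
    exact inv_mul_le_one
  · rw [norm_smul, Real.norm_of_nonneg hα.le]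
    exact mul_le_of_le_one_right hα.le he
  · rw [real_inner_smul_left]
    exact mul_le_mul_of_nonneg_left (hex y hy) hα.le
  · rw [lag_eq, Finset.sum_congr rfl fun i _ => hue i, real_inner_smul_left, real_inner_smul_left,
      real_inner_self_eq_norm_sq, sq, ← mul_assoc, inv_mul_mul_self]
    ring

end Problem

end RobustPAPC

end

theorem mainTheorem2 {n m r : ℕ} (P : RobustPAPC.Problem n m r)
    -- the rows of `A` are linearly independent
    (hA : LinearIndependent ℝ P.A.row)
    -- an optimal solution, a Slater point, and a strict lower bound on the optimal value
    (xstar : RobustPAPC.Vec n) (hopt : P.IsOptimal xstar)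
    (xhat : RobustPAPC.Vec n) (ε : ℝ) (hslater : P.IsSlater xhat ε)
    (v : ℝ) (hv : v < inner ℝ P.c xstar)
    -- step sizes
    (τ : ℝ) (hτ : 0 < τ) (θ : Fin m → ℝ) (hθ : ∀ i, 0 < θ i) (θw : ℝ) (hθw : 0 < θw)
    (θπ : ℝ) (hθπ : 0 < θπ) (hH : (P.H τ θ θw θπ).PosDef)
    -- the iterates
    (x : ℕ → RobustPAPC.Vec n) (u : ℕ → (i : Fin m) → RobustPAPC.Lifted (P.dim i))
    (w : ℕ → RobustPAPC.Vec r) (π : ℕ → RobustPAPC.Vec n)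
    (hseq : P.IsPAPC τ θ θw θπ x u w π)
    (N : ℕ) (hN : 1 ≤ N) :
    (∀ α : ℝ, 0 < α →
      (∑ i, max (P.f i (RobustPAPC.ergodic x N)) 0)
          + ‖RobustPAPC.act P.A (RobustPAPC.ergodic x N) - P.b‖
          + α * Metric.infDist (RobustPAPC.ergodic x N) P.X
        ≤ P.Γ / (2 * N) *
            (‖xstar - x 0‖ ^ 2 / τ
              + ∑ i, max (P.lamBar xhat v + 1) (u 0 i).snd ^ 2 / θ i
              + (‖π 0‖ ^ 2 + (P.Rπ xhat ε v + α) ^ 2) / θπ)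
          + (P.Rw xhat ε v + 1 + ‖w 0‖) ^ 2 / (2 * N * θw)) ∧
    |inner ℝ P.c (RobustPAPC.ergodic x N - xstar)|
      ≤ P.Γ / (2 * N) *
          (‖xstar - x 0‖ ^ 2 / τ
            + ∑ i, max (2 * P.lamBar xhat v) (u 0 i).snd ^ 2 / θ i
            + (‖π 0‖ ^ 2 + 4 * P.Rπ xhat ε v ^ 2) / θπ)
        + (2 * P.Rw xhat ε v + ‖w 0‖) ^ 2 / (2 * N * θw) := by
  obtain ⟨us, ws, πs, ss, hus, hlam, hws, hπs, hss, hlag⟩ :=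
    P.exists_bounded_dual hA hopt hslater hv
  have hlb := P.lamBar_nonneg hslater.neg (hslater.lt_inner hopt hv)
  have hRw := (norm_nonneg _).trans hws
  have hRπ := (norm_nonneg _).trans hπs
  have gap := @RobustPAPC.Problem.IsPAPC.ergodic_gap_le_of_bounds n m r P τ hτ θ hθ θw hθw θπ hθπ
    hH x u w π hseq xstar hopt.1
  refine ⟨fun α hα => ?_, ?_⟩
  · obtain ⟨ud, wd, πd, sd, hud, hud1, hwd, hπd, hsd, hlagd⟩ :=
      P.exists_violation_direction ⟨_, hopt.1.1⟩ (RobustPAPC.ergodic x N) hα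
    -- By `lag_add` the terms cᵀx̄ cancel, leaving cᵀx* plus the violation.
    have key := @gap (us + ud) (fun i => RobustPAPC.Problem.U_add (hus i) (hud i)) (ws + wd)
      (πs + πd) (ss + sd) (fun y hy => by
        rw [inner_add_left]; exact add_le_add (hss y hy) (hsd y hy)) N hN
      (P.lamBar xhat v + 1) (P.Rw xhat ε v + 1) (P.Rπ xhat ε v + α)
      (fun i => add_le_add (hlam i) (hud1 i)) (norm_add_le_of_le hws hwd)
      (norm_add_le_of_le hπs hπd)
    rw [P.lag_add, hlag, hlagd] at key
    linarith
  · have two_smul_norm : ∀ {k : ℕ} (a : RobustPAPC.Vec k) {b : ℝ}, ‖a‖ ≤ b →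
        ‖(2 : ℝ) • a‖ ≤ 2 * b := fun a b hab => by
      rw [norm_smul, Real.norm_of_nonneg zero_le_two]; gcongr
    -- At 2y* the Lagrangian is 2cᵀx* − cᵀx̄, which bounds cᵀx̄ from below.
    have lower := @gap ((2 : ℝ) • us) (fun i => RobustPAPC.Problem.U_smul (hus i) zero_le_two)
      ((2 : ℝ) • ws) ((2 : ℝ) • πs) (2 * ss) (fun y hy => by
        rw [real_inner_smul_left]; exact mul_le_mul_of_nonneg_left (hss y hy) zero_le_two) N hN
      (2 * P.lamBar xhat v) (2 * P.Rw xhat ε v) (2 * P.Rπ xhat ε v)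
      (fun i => mul_le_mul_of_nonneg_left (hlam i) zero_le_two) (two_smul_norm _ hws)
      (two_smul_norm _ hπs)
    -- At y' = 0 the Lagrangian is cᵀx̄; the bounds for 2y* are kept so that both sides share one
    -- right-hand side.
    have upper := @gap 0 (fun i => RobustPAPC.Problem.U_zero) 0 0 0 (fun y _ => by simp) N hN
      (2 * P.lamBar xhat v) (2 * P.Rw xhat ε v) (2 * P.Rπ xhat ε v)
      (fun i => mul_nonneg zero_le_two hlb) (by simpa using hRw) (by simpa using hRπ)
    rw [P.lag_smul, hlag] at lower
    have e : P.lag (RobustPAPC.ergodic x N) 0 0 0 0 = inner ℝ P.c (RobustPAPC.ergodic x N) := by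
      simp [RobustPAPC.Problem.lag_eq]
    rw [e] at upper
    rw [show (2 * P.Rπ xhat ε v) ^ 2 = 4 * P.Rπ xhat ε v ^ 2 by ring] at lower upper
    rw [inner_sub_right, abs_le]
    constructor <;> linarith
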